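/- Let $\mathbb H=\{z=x+iy: y>0\}$, let $SL_2(\mathbb R)$ act on $\mathbb H$ by Möbius transformations, and let $S=\begin{pmatrix}0&1\\-1&0\end{pmatrix}$, $U=\begin{pmatrix}1&0\\0&-1\end{pmatrix}$, so that $e^{tS}=\begin{pmatrix}\cos t&\sin t\\-\sin t&\cos t\end{pmatrix}$ and $e^{tU}=\begin{pmatrix}e^{t}&0\\0&e^{-t}\end{pmatrix}$. Let $\mu$ be given by $e^{\mu}=\cot\frac{\pi}{8}+\sqrt{\cot^2\frac{\pi}{8}-1}$ and put $$\gamma_j=e^{\theta_jS}\,e^{\mu U}\,e^{-\theta_jS},\qquad \theta_j=\tfrac{(j-1)\pi}{8},\qquad j=1,2,3,4 ;$$ these generate the Fuchsian group $\Gamma$ of the $\{8,8\}$ tiling (a regular $8$-gon with opposite edges identified). For $B\in\mathbb R$ consider the operators $\hat S_B=(1+x^2-y^2)\partial_x+2xy\,\partial_y+2iBy$ and $\hat U_B=2x\,\partial_x+2y\,\partial_y$. The one-parameter groups that they generate are $$(e^{t\hat S_B}f)(z)=\exp\Big(\int_0^t 2iB\,\mathrm{Im}(e^{rS}z)\,dr\Big)f(e^{tS}z),\qquad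 (e^{t\hat U_B}f)(z)=f(e^{2t}z).$$ The magnetic Fuchsian group $\Gamma[B]$ is the group generated by the operators $$\hat\gamma_j^B=e^{-\theta_j\hat S_B}\,e^{\mu\hat U_B}\,e^{\theta_j\hat S_B},\qquad j=1,2,3,4,$$ and for $\hat\gamma\in\Gamma[B]$ let $j(\hat\gamma,z)=(\hat\gamma 1)(z)$ be its phase factor. Let $B=\frac{p}{2q}$ with coprime integers $p$ and $q\ge 1$, and let $\phi=4\pi B$ be the magnetic flux through the regular $8$-gon. (i) The phase factor is a $U(1)$-valued factor of automorphy: for every $\hat\gamma\in\Gamma[B]$ there is $\gamma\in\Gamma$ such that, for all $z\in\mathbb H$, $|j(\hat\gamma,z)|=1$, $(\hat\gamma f)(z)=j(\hat\gamma,z)f(\gamma z)$ for all functions $f:\mathbb H\to\mathbb C$, and $j(\hat\gamma\hat\gamma',z)=j(\hat\gamma,z)\,j(\hat\gamma',\gamma z)$ for all $\hat\gamma'\in\Gamma[B]$. (ii) There exist functions $\psi_{n,k}:\mathbb H\to\mathbb C$ ($n\in\mathbb Z$, $k=(k_1,k_2,k_3,k_4)\in\mathbb R^4$), with $\psi_{n+q,k}=\psi_{n,k}$,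 such that for every $k$ every $\psi_{n,k}$ is smooth ($C^\infty$), the functions $\psi_{0,k},\dots,\psi_{q-1,k}$ are linearly independent over $\mathbb C$ (in particular non-zero), and for all $n$ and all $z\in\mathbb H$ $$\begin{aligned} \hat\gamma_1^B\psi_{n,k}(z)&=j(\hat\gamma_1^B,z)\,\psi_{n,k}(\gamma_1z)=e^{ik_1}\psi_{n+1,k}(z),\\ (\hat\gamma_1^B)^q\psi_{n,k}(z)&=e^{ik_1q}\psi_{n+q,k}(z)=e^{ik_1q}\psi_{n,k}(z),\\ \hat\gamma_2^B\psi_{n,k}(z)&=j(\hat\gamma_2^B,z)\,\psi_{n,k}(\gamma_2z)=e^{ik_2-in\phi}\psi_{n,k}(z),\\ \hat\gamma_a^B\psi_{n,k}(z)&=j(\hat\gamma_a^B,z)\,\psi_{n,k}(\gamma_az)=e^{ik_a}\psi_{n,k}(z)\qquad(a=3,4). \end{aligned}$$ -/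

import Mathlib

open scoped UpperHalfPlane MatrixGroups Manifold ContDiff

noncomputable section

namespace MagneticBloch

/-! ### The Fuchsian group of the `{8,8}` tiling -/

/-- The rotation `e^{tS}`, where `S = !![0, 1; -1, 0]`. -/
def rotS (t : ℝ) : SL(2, ℝ) :=
  ⟨!![Real.cos t, Real.sin t; -Real.sin t, Real.cos t], by
    rw [Matrix.det_fin_two_of]; nlinarith [Real.sin_sq_add_cos_sq t]⟩

/-- The scaling `e^{mU}`, where `U = !![1, 0; 0, -1]`. -/
def scaleU (m : ℝ) : SL(2, ℝ) :=
  ⟨!![Real.exp m, 0; 0, Real.exp (-m)], by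
    rw [Matrix.det_fin_two_of, ← Real.exp_add]; simp⟩

/-- The number `μ` with `e^μ = cot (π/8) + √(cot² (π/8) - 1)`. -/
def mu : ℝ :=
  Real.log (Real.cos (Real.pi / 8) / Real.sin (Real.pi / 8)
    + √(Real.cos (Real.pi / 8) ^ 2 / Real.sin (Real.pi / 8) ^ 2 - 1))

/-- The angle of rotation of the generator with index `a + 1`. -/
def angle (a : Fin 4) : ℝ := (a : ℝ) * Real.pi / 8

/-- The generators of the Fuchsian group of the `{8,8}` tiling; the index `a : Fin 4` stands for
the generator `γ_{a+1}`. -/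
def fuchsianGen (a : Fin 4) : SL(2, ℝ) :=
  rotS (angle a) * scaleU mu * rotS (-angle a)

/-- The Fuchsian group `Γ` of the `{8,8}` tiling. -/
def fuchsianGroup : Subgroup SL(2, ℝ) := Subgroup.closure (Set.range fuchsianGen)

/-! ### The infinitesimal magnetic generators -/

/-- `∂f/∂x`. -/
def partialX (f : ℍ → ℂ) (z : ℍ) : ℂ :=
  fderiv ℝ (fun w : ℂ => f (UpperHalfPlane.ofComplex w)) (z : ℂ) 1

/-- `∂f/∂y`. -/
def partialY (f : ℍ → ℂ) (z : ℍ) : ℂ :=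
  fderiv ℝ (fun w : ℂ => f (UpperHalfPlane.ofComplex w)) (z : ℂ) Complex.I

/-- `Ŝ_B = (1 + x² - y²) ∂/∂x + 2xy ∂/∂y + 2iBy`. -/
def opS (B : ℝ) (f : ℍ → ℂ) (z : ℍ) : ℂ :=
  ((1 + z.re ^ 2 - z.im ^ 2 : ℝ) : ℂ) * partialX f z + ((2 * z.re * z.im : ℝ) : ℂ) * partialY f z
    + 2 * Complex.I * (B : ℂ) * (z.im : ℂ) * f z

/-- `Û_B = 2x ∂/∂x + 2y ∂/∂y`. -/
def opU (f : ℍ → ℂ) (z : ℍ) : ℂ :=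
  ((2 * z.re : ℝ) : ℂ) * partialX f z + ((2 * z.im : ℝ) : ℂ) * partialY f z

/-! ### Their exponentials -/

lemma rotS_zero : rotS 0 = 1 := by
  ext i j; fin_cases i <;> fin_cases j <;> simp [rotS]

lemma rotS_add (s t : ℝ) : rotS (s + t) = rotS s * rotS t := by
  apply Subtype.ext
  change (rotS (s + t)).1 = (rotS s).1 * (rotS t).1
  ext i j
  fin_cases i <;> fin_cases j <;>
    simp [rotS, Real.cos_add, Real.sin_add] <;> ring

lemma scaleU_zero : scaleU 0 = 1 := by
  ext i j; fin_cases i <;> fin_cases j <;> simp [scaleU]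

lemma scaleU_add (s t : ℝ) : scaleU (s + t) = scaleU s * scaleU t := by
  apply Subtype.ext
  change (scaleU (s + t)).1 = (scaleU s).1 * (scaleU t).1
  ext i j
  fin_cases i <;> fin_cases j <;>
    simp [scaleU, Real.exp_add, mul_comm]

lemma rotS_denom_ne_zero (t : ℝ) (z : ℍ) :
    -(Real.sin t : ℂ) * (z : ℂ) + (Real.cos t : ℂ) ≠ 0 := by
  intro h
  have h1 := congrArg Complex.im h
  have h2 := congrArg Complex.re h
  simp only [Complex.add_im, Complex.add_re, Complex.mul_im, Complex.mul_re, Complex.neg_im,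
    Complex.neg_re, Complex.ofReal_im, Complex.ofReal_re, Complex.zero_im, Complex.zero_re] at h1 h2
  have hz : (z : ℂ).im ≠ 0 := z.im_pos.ne'
  have hs : Real.sin t = 0 := by
    have : Real.sin t * (z : ℂ).im = 0 := by linarith
    exact (mul_eq_zero.mp this).resolve_right hz
  have hc : Real.cos t = 0 := by rw [hs] at h2; linarith
  have := Real.sin_sq_add_cos_sq t
  rw [hs, hc] at this
  norm_num at this

lemma coe_rotS_smul (t : ℝ) (z : ℍ) :
    ((rotS t • z : ℍ) : ℂ) = ((Real.cos t : ℂ) * z + Real.sin t)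
      / (-(Real.sin t : ℂ) * z + Real.cos t) := by
  rw [UpperHalfPlane.coe_specialLinearGroup_apply]
  simp [rotS]

lemma coe_scaleU_smul (t : ℝ) (z : ℍ) :
    ((scaleU t • z : ℍ) : ℂ) = (Real.exp (2 * t) : ℂ) * z := by
  rw [UpperHalfPlane.coe_specialLinearGroup_apply]
  simp only [scaleU]
  simp [Complex.exp_neg, two_mul, Complex.exp_add]
  ring

lemma continuous_im_rotS (z : ℍ) : Continuous fun r : ℝ => (rotS r • z : ℍ).im := by
  have h : Continuous fun r : ℝ => ((rotS r • z : ℍ) : ℂ) := by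
    simp only [coe_rotS_smul]
    refine Continuous.div ?_ ?_ (fun r => rotS_denom_ne_zero r z)
    · fun_prop
    · fun_prop
  exact Complex.continuous_im.comp h

/-- The phase `j(e^{tŜ_B}, z) = exp (∫_0^t 2iB y(r) dr)` with `y(r) = Im (e^{rS} z)`. -/
def phaseS (B t : ℝ) (z : ℍ) : ℂ :=
  Complex.exp (2 * Complex.I * (B : ℂ) * ((∫ r in (0 : ℝ)..t, (rotS r • z : ℍ).im : ℝ) : ℂ))

lemma phaseS_zero (B : ℝ) (z : ℍ) : phaseS B 0 z = 1 := by simp [phaseS]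

lemma phaseS_add (B s t : ℝ) (z : ℍ) :
    phaseS B (s + t) z = phaseS B s z * phaseS B t (rotS s • z) := by
  have h1 : (∫ r in (0 : ℝ)..t, (rotS r • (rotS s • z) : ℍ).im)
      = ∫ r in s..(s + t), (rotS r • z : ℍ).im := by
    have := intervalIntegral.integral_comp_add_right (a := 0) (b := t)
      (fun r : ℝ => (rotS r • z : ℍ).im) s
    rw [zero_add, add_comm t s] at this
    rw [← this]
    simp only [rotS_add, mul_smul]
  have h2 := intervalIntegral.integral_add_adjacent_intervals
    ((continuous_im_rotS z).intervalIntegrable (μ := MeasureTheory.volume) 0 s)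
    ((continuous_im_rotS z).intervalIntegrable (μ := MeasureTheory.volume) s (s + t))
  rw [phaseS, phaseS, phaseS, ← Complex.exp_add, h1, ← h2]
  push_cast
  ring_nf

/-- `e^{tŜ_B}`, that is, `(e^{tŜ_B} f)(z) = j(e^{tŜ_B}, z) f(e^{tS} z)`, as an invertible linear
operator on functions. By `expS_zero`, `expS_add` and `hasDerivAt_expS` this is the one-parameter
group that is generated by `Ŝ_B`. -/
def expS (B t : ℝ) : (ℍ → ℂ) ≃ₗ[ℂ] (ℍ → ℂ) where
  toFun f z := phaseS B t z * f (rotS t • z)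
  invFun f z := phaseS B (-t) z * f (rotS (-t) • z)
  map_add' f g := by ext z; simp [mul_add]
  map_smul' c f := by ext z; simp; ring
  left_inv f := by
    ext z
    dsimp only
    rw [← mul_assoc, ← phaseS_add, ← mul_smul, ← rotS_add]
    simp [phaseS_zero, rotS_zero]
  right_inv f := by
    ext z
    dsimp only
    rw [← mul_assoc, ← phaseS_add, ← mul_smul, ← rotS_add]
    simp [phaseS_zero, rotS_zero]

/-- `e^{mÛ_B}`, that is, `(e^{mÛ_B} f)(z) = f(e^{mU} z) = f(e^{2m} z)`. By `expU_zero`, `expU_add`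
and `hasDerivAt_expU` this is the one-parameter group that is generated by `Û_B`. -/
def expU (m : ℝ) : (ℍ → ℂ) ≃ₗ[ℂ] (ℍ → ℂ) where
  toFun f z := f (scaleU m • z)
  invFun f z := f (scaleU (-m) • z)
  map_add' f g := by ext z; simp
  map_smul' c f := by ext z; simp
  left_inv f := by
    ext z
    simp only [← mul_smul, ← scaleU_add]
    simp [scaleU_zero]
  right_inv f := by
    ext z
    simp only [← mul_smul, ← scaleU_add]
    simp [scaleU_zero]

lemma expS_zero (B : ℝ) : expS B 0 = 1 := by
  ext f z; simp [expS, phaseS_zero, rotS_zero]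

lemma expS_add (B s t : ℝ) : expS B (s + t) = expS B s * expS B t := by
  ext f z
  change phaseS B (s + t) z * f (rotS (s + t) • z)
    = phaseS B s z * (phaseS B t (rotS s • z) * f (rotS t • rotS s • z))
  rw [phaseS_add, ← mul_smul, ← rotS_add, add_comm t s, mul_assoc]

lemma expU_zero : expU 0 = 1 := by
  ext f z; simp [expU, scaleU_zero]

lemma expU_add (s t : ℝ) : expU (s + t) = expU s * expU t := by
  ext f z
  change f (scaleU (s + t) • z) = f (scaleU t • scaleU s • z)
  rw [← mul_smul, ← scaleU_add, add_comm t s]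

lemma fderiv_apply_eq (f : ℍ → ℂ) (z : ℍ) (a b : ℝ) :
    fderiv ℝ (fun w : ℂ => f (UpperHalfPlane.ofComplex w)) (z : ℂ) (a + b * Complex.I)
      = (a : ℂ) * partialX f z + (b : ℂ) * partialY f z := by
  have h : (a : ℂ) + b * Complex.I = a • (1 : ℂ) + b • Complex.I := by simp
  rw [h, map_add, map_smul, map_smul]
  simp [partialX, partialY]

/-- `Ŝ_B` is the generator of `t ↦ e^{tŜ_B}`. -/
lemma hasDerivAt_expS (B : ℝ) (f : ℍ → ℂ) (z : ℍ)
    (hf : DifferentiableAt ℝ (fun w : ℂ => f (UpperHalfPlane.ofComplex w)) (z : ℂ)) :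
    HasDerivAt (fun t : ℝ => expS B t f z) (opS B f z) 0 := by
  have hcurve : HasDerivAt (fun t : ℝ => ((rotS t • z : ℍ) : ℂ)) (1 + (z : ℂ) ^ 2) 0 := by
    simp only [coe_rotS_smul]
    have hc : HasDerivAt (fun t : ℝ => ((Real.cos t : ℝ) : ℂ)) ((-Real.sin 0 : ℝ) : ℂ) 0 :=
      (Real.hasDerivAt_cos 0).ofReal_comp
    have hs : HasDerivAt (fun t : ℝ => ((Real.sin t : ℝ) : ℂ)) ((Real.cos 0 : ℝ) : ℂ) 0 :=
      (Real.hasDerivAt_sin 0).ofReal_comp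
    have := ((hc.mul_const (z : ℂ)).add hs).div ((hs.neg.mul_const (z : ℂ)).add hc)
      (rotS_denom_ne_zero 0 z)
    refine this.congr_deriv ?_
    simp
    ring
  have hz : (z : ℂ) = ((rotS 0 • z : ℍ) : ℂ) := by rw [rotS_zero, one_smul]
  have hF : HasDerivAt (fun t : ℝ => f (rotS t • z))
      (fderiv ℝ (fun w : ℂ => f (UpperHalfPlane.ofComplex w)) (z : ℂ) (1 + (z : ℂ) ^ 2)) 0 := by
    have h1 : HasFDerivAt (fun w : ℂ => f (UpperHalfPlane.ofComplex w))
        (fderiv ℝ (fun w : ℂ => f (UpperHalfPlane.ofComplex w)) (z : ℂ))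
        ((rotS 0 • z : ℍ) : ℂ) := by rw [← hz]; exact hf.hasFDerivAt
    have h2 := h1.comp_hasDerivAt (0 : ℝ) hcurve
    simpa [Function.comp_def] using h2
  have hint : HasDerivAt (fun t : ℝ => ∫ r in (0 : ℝ)..t, (rotS r • z : ℍ).im) z.im 0 := by
    have := ((continuous_im_rotS z).integral_hasStrictDerivAt 0 0).hasDerivAt
    simpa [rotS_zero] using this
  have hphase : HasDerivAt (fun t : ℝ => phaseS B t z)
      (2 * Complex.I * (B : ℂ) * (z.im : ℂ)) 0 := by
    have := ((hint.ofReal_comp).const_mul (2 * Complex.I * (B : ℂ))).cexp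
    simpa [phaseS] using this
  have hprod := hphase.mul hF
  refine (hprod.congr_deriv ?_)
  have hv : (1 : ℂ) + (z : ℂ) ^ 2 = ((1 + z.re ^ 2 - z.im ^ 2 : ℝ) : ℂ)
      + ((2 * z.re * z.im : ℝ) : ℂ) * Complex.I := by
    have : (z : ℂ) = (z.re : ℂ) + (z.im : ℂ) * Complex.I := (Complex.re_add_im (z : ℂ)).symm
    rw [this]
    push_cast
    linear_combination ((z.im : ℂ) ^ 2) * Complex.I_sq
  rw [hv, fderiv_apply_eq, phaseS_zero, rotS_zero, one_smul, opS]
  ring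

/-- `Û_B` is the generator of `m ↦ e^{mÛ_B}`. -/
lemma hasDerivAt_expU (f : ℍ → ℂ) (z : ℍ)
    (hf : DifferentiableAt ℝ (fun w : ℂ => f (UpperHalfPlane.ofComplex w)) (z : ℂ)) :
    HasDerivAt (fun t : ℝ => expU t f z) (opU f z) 0 := by
  have hcurve : HasDerivAt (fun t : ℝ => ((scaleU t • z : ℍ) : ℂ)) (2 * (z : ℂ)) 0 := by
    simp only [coe_scaleU_smul]
    have h : HasDerivAt (fun t : ℝ => Real.exp (2 * t)) 2 0 := by
      simpa using ((hasDerivAt_id (0 : ℝ)).const_mul 2).exp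
    simpa using (h.ofReal_comp).mul_const (z : ℂ)
  have hz : (z : ℂ) = ((scaleU 0 • z : ℍ) : ℂ) := by rw [scaleU_zero, one_smul]
  have h1 : HasFDerivAt (fun w : ℂ => f (UpperHalfPlane.ofComplex w))
      (fderiv ℝ (fun w : ℂ => f (UpperHalfPlane.ofComplex w)) (z : ℂ))
      ((scaleU 0 • z : ℍ) : ℂ) := by rw [← hz]; exact hf.hasFDerivAt
  have h2 := h1.comp_hasDerivAt (0 : ℝ) hcurve
  have h3 : HasDerivAt (fun t : ℝ => expU t f z)
      (fderiv ℝ (fun w : ℂ => f (UpperHalfPlane.ofComplex w)) (z : ℂ) (2 * (z : ℂ))) 0 := by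
    simpa [Function.comp_def, expU] using h2
  refine h3.congr_deriv ?_
  have hv : 2 * (z : ℂ) = ((2 * z.re : ℝ) : ℂ) + ((2 * z.im : ℝ) : ℂ) * Complex.I := by
    have : (z : ℂ) = (z.re : ℂ) + (z.im : ℂ) * Complex.I := (Complex.re_add_im (z : ℂ)).symm
    rw [this]
    push_cast
    ring
  rw [hv, fderiv_apply_eq, opU]

/-! ### The magnetic Fuchsian group -/

/-- The generators `γ̂_{a+1}^B = e^{-θ Ŝ_B} e^{μ Û_B} e^{θ Ŝ_B}`, `θ = aπ/8`, of the magnetic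
Fuchsian group; the product is the composition of operators. -/
def magneticGen (B : ℝ) (a : Fin 4) : (ℍ → ℂ) ≃ₗ[ℂ] (ℍ → ℂ) :=
  expS B (-angle a) * expU mu * expS B (angle a)

/-- The magnetic Fuchsian group `Γ[B]` of the `{8,8}` tiling. -/
def magneticFuchsianGroup (B : ℝ) : Subgroup ((ℍ → ℂ) ≃ₗ[ℂ] (ℍ → ℂ)) :=
  Subgroup.closure (Set.range (magneticGen B))

/-- The phase factor `j(γ̂, z)` of an operator of the form `(γ̂ f)(z) = j(γ̂, z) f(γ z)`: the value
at `z` of the image of the constant function `1`. -/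
def phaseFactor (E : (ℍ → ℂ) ≃ₗ[ℂ] (ℍ → ℂ)) (z : ℍ) : ℂ := E (fun _ => 1) z

end MagneticBloch

end

/-!
The phase of `e^{tŜ_B}` is `exp (-2iB arg (cos t - z sin t))` for `|t| < π`
(`phaseS_eq`), so the operators `γ̂` are the weight `-2B` action of elements of the universal cover
of `SL₂(ℝ)`, and part (i) holds by induction on words (`exists_fuchsian_of_mem`).

For part (ii) let `s_j = e^{θS} e^{μU} e^{-θS}` with `θ = jπ/8`, for all `j : ℤ` (`fuchsianSide`), so
that `s_0, …, s_3` are the generators, `s_{j+4} = s_j⁻¹`, and `s_0, …, s_7` carry the octagon about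
`i` to its eight neighbours. The product `s_0 s_3 s_6 ⋯ s_21` goes once around a vertex. It
telescopes to `(e^{μU} e^{3πS/8})^8 e^{-3πS}`, and `e^{μU} e^{3πS/8}` is a rotation about the vertex,
conjugate to `e^{πS/8}` by an upper triangular matrix. As upper triangular matrices act without a
phase, the same computation holds for the operators: the product is `1` in `SL₂(ℝ)`
(`octagonRelator_fuchsianSide`) and, for the inverse operators, the scalar `e^{iφ}`
(`octagonRelator_magneticSide`). The operators `blochOp B p k a` on `q`-tuples of functions combine
the operators `γ̂_{a+1}` with the scalars and the shift of the index that the Bloch conditions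
prescribe; the commutator of the shift with the scalars `e^{inφ}` cancels `e^{iφ}`, so these operators
define an action of the abstract surface group `OctagonGroup`, with the octagon relation as its only
relation (`octagonRelator_blochOp`, `toBlochOp`). The wanted tuples are its fixed points.

A fixed point is the sum over `OctagonGroup` of the translates of a bump function near `i`
(`poincareSeries`). It is locally a single translate, hence smooth, and it does not vanish at `i`,
because distinct elements of `OctagonGroup` move `i` to points at distance more than `μ`
(`mu_lt_dist_toFuchsian`). This is the substance of Poincaré's polygon theorem for the octagon. It is
proved as in Tits' treatment of Coxeter groups (`exists_pos_of_ne_one`): the octagon with angles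
`π/4` is a Coxeter polygon, and by induction on the word length, if crossing the side `j` of the tile
`g` increases the length, then `g` lies on the same side of the geodesic through that side as the
base tile. Only the dihedral configurations of two sides enter, as linear algebra in `sl₂(ℝ)` with
its Lorentz form.

The `q` components are linearly independent since the shift makes all of them non-zero and they are
eigenvectors of `γ̂_2` with distinct eigenvalues, `p` and `q` being coprime.
-/

namespace MagneticBloch

/-! ### The vertex relation -/

section Relator

variable {G H : Type*} [Group G] [Group H]

/-- The product of the elements of a sequence along a walk around a vertex of the octagon: after the
side `j` has been crossed, the tile behind it is left through its side `j + 3`. -/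
def octagonRelator (s : ℤ → G) : G := s 0 * s 3 * s 6 * s 9 * s 12 * s 15 * s 18 * s 21

lemma map_octagonRelator (f : G →* H) (s : ℤ → G) :
    f (octagonRelator s) = octagonRelator fun j => f (s j) := by
  simp only [octagonRelator, map_mul]

end Relator

/-! ### Word length -/

section WordLength

variable {G : Type*} [Group G]

/-- `g` is the product of a word of length `n` in the letters `x j`. -/
def IsWordOfLength (x : ℤ → G) (g : G) (n : ℕ) : Prop :=
  ∃ l : List ℤ, l.length = n ∧ (l.map x).prod = g

open Classical in
/-- The least length of a word in the letters `x j` that represents `g`. -/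
noncomputable def wordLength (x : ℤ → G) (hx : ∀ g, ∃ n, IsWordOfLength x g n) (g : G) : ℕ :=
  Nat.find (hx g)

lemma exists_isWordOfLength {x : ℤ → G} (hinv : ∀ j, x (j + 4) = (x j)⁻¹)
    (hgen : Subgroup.closure (Set.range x) = ⊤) (g : G) : ∃ n, IsWordOfLength x g n := by
  have hg : g ∈ Subgroup.closure (Set.range x) := hgen ▸ Subgroup.mem_top g
  suffices ∃ l : List ℤ, (l.map x).prod = g by
    obtain ⟨l, hl⟩ := this
    exact ⟨l.length, l, rfl, hl⟩
  induction hg using Subgroup.closure_induction with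
  | mem y hy =>
    obtain ⟨j, rfl⟩ := hy
    exact ⟨[j], by simp⟩
  | one => exact ⟨[], by simp⟩
  | mul a b _ _ ha hb =>
    obtain ⟨l, rfl⟩ := ha
    obtain ⟨m, rfl⟩ := hb
    exact ⟨l ++ m, by simp⟩
  | inv a _ ha =>
    obtain ⟨l, rfl⟩ := ha
    refine ⟨(l.map (· + 4)).reverse, ?_⟩
    rw [List.prod_inv_reverse, List.map_reverse, List.map_map, List.map_map]
    simp [Function.comp_def, hinv]

variable {x : ℤ → G} (hx : ∀ g, ∃ n, IsWordOfLength x g n)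

lemma wordLength_mul_le (g : G) (j : ℤ) : wordLength x hx (g * x j) ≤ wordLength x hx g + 1 := by
  classical
  obtain ⟨l, hl, hg⟩ := Nat.find_spec (hx g)
  exact Nat.find_min' (hx (g * x j)) ⟨l ++ [j], by simp [hl, wordLength], by simp [hg]⟩

lemma exists_wordLength_mul_lt (hinv : ∀ j, x (j + 4) = (x j)⁻¹) {g : G} (hg : g ≠ 1) :
    ∃ i, wordLength x hx (g * x i) < wordLength x hx g := by
  classical
  obtain ⟨l, hl, hlg⟩ := Nat.find_spec (hx g)
  rcases List.eq_nil_or_concat l with rfl | ⟨l', i, rfl⟩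
  · exact absurd (by simpa using hlg.symm) hg
  · refine ⟨i + 4, lt_of_le_of_lt (Nat.find_min' _ ⟨l', rfl, ?_⟩) ?_⟩
    · rw [← hlg, hinv]; simp
    · rw [wordLength, ← hl]; simp

/-- A homomorphism that is `-1` on the letters detects the parity of the word length. -/
lemma map_eq_neg_one_pow_wordLength {χ : G →* ℤˣ} (hχ : ∀ j, χ (x j) = -1) (g : G) :
    χ g = (-1) ^ wordLength x hx g := by
  classical
  obtain ⟨l, hl, hg⟩ := Nat.find_spec (hx g)
  rw [wordLength, ← hl]
  conv_lhs => rw [← hg]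
  clear hl hg
  induction l with
  | nil => simp
  | cons a t ih => rw [List.map_cons, List.prod_cons, map_mul, ih, hχ, List.length_cons, pow_succ']

lemma wordLength_mul_ne {χ : G →* ℤˣ} (hχ : ∀ j, χ (x j) = -1) (g : G) (j : ℤ) :
    wordLength x hx (g * x j) ≠ wordLength x hx g := by
  intro h
  have h1 := map_eq_neg_one_pow_wordLength hx hχ (g * x j)
  rw [h, ← map_eq_neg_one_pow_wordLength hx hχ g, map_mul, hχ] at h1
  simp at h1

end WordLength

/-! ### Tits' argument for tilings by octagons -/

section Chamber

variable {G : Type*} [Group G] {x : ℤ → G}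

lemma periodic_of_inv (hinv : ∀ j, x (j + 4) = (x j)⁻¹) (j k : ℤ) : x (j + 8 * k) = x j := by
  have h : ∀ j, x (j + 8) = x j := fun j => by
    rw [show j + 8 = j + 4 + 4 by ring, hinv, hinv, inv_inv]
  simpa [mul_comm] using (show Function.Periodic x 8 from h).int_mul k j

/-- The vertex relation may be started at every side. -/
lemma cyclic_relation (hinv : ∀ j, x (j + 4) = (x j)⁻¹)
    (hrel : octagonRelator x = 1) (e : ℤ) :
    x e * x (e + 3) * x (e + 6) * x (e + 9) * x (e + 12) * x (e + 15) * x (e + 18) * x (e + 21)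
      = 1 := by
  have key : ∀ n : ℕ, x (3 * n) * x (3 * n + 3) * x (3 * n + 6) * x (3 * n + 9) * x (3 * n + 12)
      * x (3 * n + 15) * x (3 * n + 18) * x (3 * n + 21) = 1 := by
    intro n
    induction n with
    | zero => simpa [octagonRelator] using hrel
    | succ n ih =>
      have h24 : x (3 * (n + 1 : ℕ) + 21) = x (3 * n) := by
        rw [← periodic_of_inv hinv (3 * n) 3]; congr 1
      rw [h24]
      push_cast
      simp only [show (3 * ((n : ℤ) + 1)) = 3 * n + 3 by ring, add_assoc]
      norm_num
      rw [← mul_left_inj (x (3 * n))⁻¹, ← mul_right_inj (x (3 * n))]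
      simpa [mul_assoc] using ih
  have h := key (3 * (e % 8)).toNat
  have h8 : ∀ c : ℤ, x (3 * ((3 * (e % 8)).toNat : ℤ) + c) = x (e + c) := by
    intro c
    rw [← periodic_of_inv hinv (e + c) (e % 8 - e / 8)]
    congr 1
    omega
  have h80 := h8 0
  simp only [add_zero] at h80
  simpa only [h8, h80] using h

/-- The two ways around the vertex that the sides `e` and `e + 1` of a tile have in common: crossing
`e`, or making the other seven steps. -/
lemma relation_forward (hinv : ∀ j, x (j + 4) = (x j)⁻¹)
    (hrel : octagonRelator x = 1) (e : ℤ) :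
    x e = x (e + 1) * x (e + 6) * x (e + 11) * x (e + 16) *
      (x (e + 21) * x (e + 26) * x (e + 31)) := by
  have h := cyclic_relation hinv hrel e
  have p : ∀ i j : ℤ, j - i = 8 * ((j - i) / 8) → x j = x i := fun i j hij => by
    rw [← periodic_of_inv hinv i ((j - i) / 8)]; congr 1; omega
  rw [p (e + 21 + 4) (e + 1) (by omega), p (e + 18 + 4) (e + 6) (by omega),
    p (e + 15 + 4) (e + 11) (by omega), p (e + 12 + 4) (e + 16) (by omega),
    p (e + 9 + 4) (e + 21) (by omega), p (e + 6 + 4) (e + 26) (by omega),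
    p (e + 3 + 4) (e + 31) (by omega)]
  simp only [hinv]
  simp only [mul_assoc] at h
  rw [eq_inv_of_mul_eq_one_left h]
  simp [mul_assoc]

/-- The analogue of `relation_forward` for the sides `e` and `e - 1`. -/
lemma relation_backward (hinv : ∀ j, x (j + 4) = (x j)⁻¹)
    (hrel : octagonRelator x = 1) (e : ℤ) :
    x e = x (e - 1) * x (e + 2) * x (e + 5) * x (e + 8) *
      (x (e + 11) * x (e + 14) * x (e + 17)) := by
  have h := cyclic_relation hinv hrel (e - 1)
  have h20 : x (e - 1 + 21) = (x e)⁻¹ := by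
    rw [← hinv, ← periodic_of_inv hinv (e + 4) 2]; congr 1; ring
  rw [h20, mul_inv_eq_one] at h
  rw [← h]
  simp only [mul_assoc, show e - 1 + 3 = e + 2 by ring, show e - 1 + 6 = e + 5 by ring,
    show e - 1 + 9 = e + 8 by ring, show e - 1 + 12 = e + 11 by ring,
    show e - 1 + 15 = e + 14 by ring, show e - 1 + 18 = e + 17 by ring]

/-- The elements `g` stand for the tiles of a tiling by octagons, `g * x j` being the tile behind the
side `j` of `g`, and the sign of `ν g j` says on which side of the geodesic through the side `j` of
`g` a base point lies: it is negative if `g` and the base point are on the same side. The hypothesis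
`hstep` says that the side `2j + 4 - k` of `g * x j` is the mirror image of the side `k` of `g` in
the side `j`.

If `g * x j` is a longer word than `g` then `ν g j < 0`; so a last letter of a reduced word gives a
side that separates `g` from the base point. This is proved by induction on the word length, as in
Tits' theorem on Coxeter groups: if the side `i` of `g` can be crossed with the length decreasing,
one walks on around the vertex of `i` and `j`, or along the infinite gallery if these sides
have no common vertex, as long as the length decreases. At the end, `ν` is negative on both sides by
induction, and `ν g j` is a non-negative combination of these two values, not both coefficients being
zero. In the case without a common vertex the auxiliary inequality on `ν g e + ν g (e + d)` replaces the
explicit coefficients, which are unbounded there. -/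
theorem exists_pos_of_ne_one (hinv : ∀ j, x (j + 4) = (x j)⁻¹)
    (hrel : octagonRelator x = 1)
    (hgen : Subgroup.closure (Set.range x) = ⊤)
    {χ : G →* ℤˣ} (hχ : ∀ j, χ (x j) = -1) {ν : G → ℤ → ℝ} {a : ℤ → ℝ}
    (hν : ∀ j, ν 1 j < 0)
    (hstep : ∀ g j k, ν (g * x j) (2 * j + 4 - k) = ν g k + a (k - j) * ν g j)
    (ha0 : a 0 = -2) (ha1 : a 1 = √2) (ha1' : a (-1) = √2)
    (ha : ∀ d, 2 ≤ d → d ≤ 6 → 2 ≤ a (-d)) {g : G} (hg : g ≠ 1) :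
    ∃ j, 0 < ν g j := by
  have hx := exists_isWordOfLength hinv hgen
  set ℓ := wordLength x hx
  have hle : ∀ g j, ℓ (g * x j) ≤ ℓ g + 1 := wordLength_mul_le hx
  have hne : ∀ g j, ℓ (g * x j) ≠ ℓ g := wordLength_mul_ne hx hχ
  have hback : ∀ g j, g * x j * x (j + 4) = g := fun g j => by rw [hinv]; simp
  have h2 : (√2 : ℝ) * √2 = 2 := Real.mul_self_sqrt (by norm_num)
  have hs1 : (1 : ℝ) ≤ √2 := Real.one_le_sqrt.mpr (by norm_num)
  -- one step of the walk around the vertex of the sides `e` and `e + d`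
  -- Crossing the side `e + d` turns the pair of walls `(e, e + d)` of `g` into the walls
  -- `(e + d + 4 + d, e + d + 4)` of the next tile: the difference `d` is preserved.
  have walk' : ∀ g e d, ν g (e + d) = -ν (g * x (e + d)) (e + d + 4) := by
    intro g e d
    have h := hstep g (e + d) (e + d)
    rw [sub_self, ha0, show 2 * (e + d) + 4 - (e + d) = e + d + 4 by ring] at h
    linarith
  have walk : ∀ g e d, ν g e = ν (g * x (e + d)) (e + d + 4 + d)
      + a (-d) * ν (g * x (e + d)) (e + d + 4) := by
    intro g e d
    have h := hstep g (e + d) e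
    rw [show 2 * (e + d) + 4 - e = e + d + 4 + d by ring, show e - (e + d) = -d by ring,
      walk' g e d] at h
    linarith
  have up : ∀ h i, ℓ (h * x i) < ℓ h → ℓ (h * x i) < ℓ (h * x i * x (i + 4)) :=
    fun h i hi => by rwa [hback]
  have main : ∀ n g, ℓ g = n → ∀ e, ℓ g < ℓ (g * x e) →
      ν g e < 0 ∧ ∀ d, 2 ≤ d → d ≤ 6 → ν g e + ν g (e + d) ≤ 0 := by
    intro n
    induction n using Nat.strong_induction_on with
    | _ n ih =>
    intro g hgn
    have neg : ∀ h, ℓ h < ℓ g → ∀ i, ℓ h < ℓ (h * x i) → ν h i < 0 :=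
      fun h hh i hi => (ih _ (hgn ▸ hh) h rfl i hi).1
    -- two sides with a common vertex
    have adj : ∀ e d, a (-d) = √2 → x e = x (e + d) * x (e + d + 4 + d) *
        x (e + d + 4 + d + 4 + d) * x (e + d + 4 + d + 4 + d + 4 + d) *
        (x (e + d + 4 + d + 4 + d + 4 + d + 4 + d) *
          x (e + d + 4 + d + 4 + d + 4 + d + 4 + d + 4 + d) *
          x (e + d + 4 + d + 4 + d + 4 + d + 4 + d + 4 + d + 4 + d)) →
        ℓ g < ℓ (g * x e) → ℓ (g * x (e + d)) < ℓ g → ν g e < 0 := by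
      intro e d had hcyc he h1
      have w0 := walk g e d
      rw [had] at w0
      rcases lt_or_gt_of_ne (hne (g * x (e + d)) (e + d + 4 + d)) with h2lt | h2gt
      swap
      · nlinarith [neg _ h1 _ (up _ _ h1), neg _ h1 _ h2gt]
      have w1 := walk (g * x (e + d)) (e + d + 4) d
      have v1 := walk' (g * x (e + d)) (e + d + 4) d
      rw [had] at w1
      have hl2 := h2lt.trans h1
      rcases lt_or_gt_of_ne (hne (g * x (e + d) * x (e + d + 4 + d)) (e + d + 4 + d + 4 + d))
        with h3lt | h3gt
      swap
      · nlinarith [neg _ hl2 _ (up _ _ h2lt), neg _ hl2 _ h3gt]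
      have w2 := walk (g * x (e + d) * x (e + d + 4 + d)) (e + d + 4 + d + 4) d
      have v2 := walk' (g * x (e + d) * x (e + d + 4 + d)) (e + d + 4 + d + 4) d
      rw [had] at w2
      have hl3 := h3lt.trans hl2
      rcases lt_or_gt_of_ne (hne (g * x (e + d) * x (e + d + 4 + d) * x (e + d + 4 + d + 4 + d))
        (e + d + 4 + d + 4 + d + 4 + d)) with h4lt | h4gt
      swap
      · have hv := neg _ hl3 _ h4gt
        refine lt_of_eq_of_lt ?_ hv
        linear_combination w0 + v1 + √2 * w1 + √2 * v2 + w2 +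
          ν (g * x (e + d) * x (e + d + 4 + d)) (e + d + 4 + d + 4) * h2
      -- After four steps down the tile opposite to `g` at the vertex is reached. The tile `g * x e`
      -- is three steps away from it, so it cannot be farther from the base tile than `g`.
      exfalso
      have hge : g * x e = g * x (e + d) * x (e + d + 4 + d) * x (e + d + 4 + d + 4 + d) *
          x (e + d + 4 + d + 4 + d + 4 + d) * x (e + d + 4 + d + 4 + d + 4 + d + 4 + d) *
          x (e + d + 4 + d + 4 + d + 4 + d + 4 + d + 4 + d) *
          x (e + d + 4 + d + 4 + d + 4 + d + 4 + d + 4 + d + 4 + d) := by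
        rw [hcyc]; simp only [mul_assoc]
      rw [hge] at he
      refine absurd he (not_lt.mpr ?_)
      refine (hle _ _).trans ((Nat.add_le_add_right (hle _ _) 1).trans
        ((Nat.add_le_add_right (hle _ _) 2).trans ?_))
      omega
    -- two sides without a common vertex
    have far : ∀ e d, 2 ≤ d → d ≤ 6 → ℓ (g * x (e + d)) < ℓ g →
        ν g e < 0 ∧ ν g e + ν g (e + d) ≤ 0 := by
      intro e d hd hd' hlt
      have had := ha d hd hd'
      obtain ⟨hu, hsum⟩ := ih _ (hgn ▸ hlt) _ rfl (e + d + 4) (up _ _ hlt)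
      have hs := hsum d hd hd'
      have w := walk g e d
      have v := walk' g e d
      constructor <;> nlinarith
    have hneg : ∀ e, ℓ g < ℓ (g * x e) → ν g e < 0 := by
      intro e he
      by_cases hg1 : g = 1
      · exact hg1 ▸ hν e
      obtain ⟨i, hi⟩ := exists_wordLength_mul_lt hx hinv hg1
      have hid : x i = x (e + (i - e) % 8) := by
        rw [← periodic_of_inv hinv (e + (i - e) % 8) ((i - e) / 8)]; congr 1; omega
      rw [hid] at hi
      have hlt : (i - e) % 8 = 0 ∨ (i - e) % 8 = 1 ∨ (i - e) % 8 = 7 ∨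
        (2 ≤ (i - e) % 8 ∧ (i - e) % 8 ≤ 6) := by omega
      rcases hlt with h | h | h | ⟨h, h'⟩
      · rw [h, add_zero] at hi
        exact absurd hi he.not_gt
      · rw [h] at hi
        exact adj e 1 ha1' (by
          simpa only [add_assoc, Int.reduceAdd] using relation_forward hinv hrel e) he hi
      · rw [h, show e + 7 = e + -1 + 8 * 1 by ring, periodic_of_inv hinv] at hi
        exact adj e (-1) (by rwa [neg_neg]) (by
          simpa only [add_assoc, Int.reduceAdd, sub_eq_add_neg, Int.reduceNeg]
            using relation_backward hinv hrel e) he hi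
      · exact (far e _ h h' hi).1
    refine fun e he => ⟨hneg e he, fun d hd hd' => ?_⟩
    rcases lt_or_gt_of_ne (hne g (e + d)) with hlt | hgt
    · exact (far e d hd hd' hlt).2
    · exact (add_neg (hneg e he) (hneg _ hgt)).le
  obtain ⟨i, hi⟩ := exists_wordLength_mul_lt hx hinv hg
  refine ⟨i, ?_⟩
  have := (main _ (g * x i) rfl (i + 4) (by rwa [hback])).1
  have h := walk' g i 0
  simp only [add_zero] at h
  linarith

end Chamber

/-! ### Rotated copies of an element -/

section RotatedGenerators

variable {G : Type*} [Group G]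

/-- The conjugate of `u` by the rotation through the angle `jπ/8`, for a one-parameter group `r` of
rotations. -/
noncomputable def rotatedConj (r : ℝ → G) (u : G) (j : ℤ) : G :=
  r (j * Real.pi / 8) * u * r (-(j * Real.pi / 8))

variable {r : ℝ → G} {u : G}

lemma rotatedConj_add_four (hr : ∀ s t, r (s + t) = r s * r t)
    (hu : r (Real.pi / 2) * u = u⁻¹ * r (Real.pi / 2)) (j : ℤ) :
    rotatedConj r u (j + 4) = (rotatedConj r u j)⁻¹ := by
  have h0 : r 0 = 1 := by simpa using hr 0 0
  have hneg : ∀ t, r (-t) = (r t)⁻¹ := fun t => by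
    rw [eq_inv_iff_mul_eq_one, ← hr, neg_add_cancel, h0]
  rw [rotatedConj, rotatedConj, hneg, hneg,
    show (((j + 4 : ℤ) : ℝ) * Real.pi / 8) = j * Real.pi / 8 + Real.pi / 2 by push_cast; ring,
    hr, mul_assoc (r (j * Real.pi / 8)), hu]
  group

/-- The walk around a vertex telescopes to `(u r(3π/8))^8 r(-3π)`. -/
lemma octagonRelator_rotatedConj (hr : ∀ s t, r (s + t) = r s * r t)
    (hpow : (u * r (3 * Real.pi / 8)) ^ 8 = r Real.pi) :
    octagonRelator (rotatedConj r u) = r (-(2 * Real.pi)) := by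
  have h0 : r 0 = 1 := by simpa using hr 0 0
  have hneg : ∀ t, r (-t) = (r t)⁻¹ := fun t => by
    rw [eq_inv_iff_mul_eq_one, ← hr, neg_add_cancel, h0]
  have hmul : ∀ n : ℕ, r (n * (3 * Real.pi / 8)) = r (3 * Real.pi / 8) ^ n := by
    intro n
    induction n with
    | zero => simp [h0]
    | succ n ih => rw [pow_succ, ← ih, ← hr]; congr 1; push_cast; ring
  have hj : ∀ n : ℕ, rotatedConj r u ((3 * n : ℕ) : ℤ) =
      r (3 * Real.pi / 8) ^ n * u * (r (3 * Real.pi / 8) ^ n)⁻¹ := by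
    intro n
    rw [rotatedConj, hneg, ← hmul]
    congr 3 <;> push_cast <;> ring_nf
  have e : r (-(2 * Real.pi)) = r Real.pi * (r (3 * Real.pi / 8) ^ 8)⁻¹ := by
    rw [← hmul, ← hneg, ← hr]; congr 1; push_cast; ring
  have h1 := hj 1
  have h2 := hj 2
  have h3 := hj 3
  have h4 := hj 4
  have h5 := hj 5
  have h6 := hj 6
  have h7 := hj 7
  have hz := hj 0
  norm_num only [Nat.cast_ofNat, Nat.cast_zero, mul_zero, mul_one] at h1 h2 h3 h4 h5 h6 h7 hz
  rw [octagonRelator, e, ← hpow, h1, h2, h3, h4, h5, h6, h7, hz]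
  generalize r (3 * Real.pi / 8) = R
  simp only [pow_succ (u * R), pow_zero, one_mul]
  group

lemma eq_of_add_four {x y : ℤ → G} (hx : ∀ j, x (j + 4) = (x j)⁻¹)
    (hy : ∀ j, y (j + 4) = (y j)⁻¹) (h : ∀ a : Fin 4, x (a : ℕ) = y (a : ℕ)) : x = y := by
  have key : ∀ (n : ℕ) (j : ℤ), 0 ≤ j → j < 4 * (n + 1) → x j = y j := by
    intro n
    induction n with
    | zero =>
      intro j h0 h4
      have := h ⟨j.toNat, by omega⟩
      simpa [h0] using this
    | succ n ih =>
      intro j h0 h4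
      by_cases hj : j < 4
      · exact ih j h0 (by push_cast at *; omega)
      · have := ih (j - 4) (by omega) (by push_cast at *; omega)
        rw [show j = j - 4 + 4 by ring, hx, hy, this]
  funext j
  rw [← periodic_of_inv hx j (-(j / 8)), ← periodic_of_inv hy j (-(j / 8))]
  exact key 1 _ (by omega) (by push_cast; omega)

end RotatedGenerators

/-! ### The constant `μ` -/

section Constants

open Real

lemma cos_sq_pi_div_eight : cos (π / 8) ^ 2 = 1 / 2 + √2 / 4 := by
  rw [cos_sq, show 2 * (π / 8) = π / 4 by ring, cos_pi_div_four]; ring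

lemma sin_sq_pi_div_eight : sin (π / 8) ^ 2 = 1 / 2 - √2 / 4 := by
  rw [sin_sq, cos_sq_pi_div_eight]; ring

lemma sin_pi_div_eight_pos : 0 < sin (π / 8) :=
  sin_pos_of_pos_of_lt_pi (by positivity) (by linarith [pi_pos])

lemma cos_pi_div_eight_pos : 0 < cos (π / 8) :=
  cos_pos_of_mem_Ioo ⟨by linarith [pi_pos], by linarith [pi_pos]⟩

lemma one_lt_sqrt_two : (1 : ℝ) < √2 := by
  rw [lt_sqrt (by norm_num)]; norm_num

lemma two_le_cot_sq : 2 ≤ (cos (π / 8) / sin (π / 8)) ^ 2 := by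
  rw [div_pow, le_div_iff₀ (by have := sin_pi_div_eight_pos; positivity), sin_sq_pi_div_eight,
    cos_sq_pi_div_eight]
  linarith [one_lt_sqrt_two]

/-- `cosh μ = cot (π/8)`. -/
lemma cosh_mu : cosh mu = cos (π / 8) / sin (π / 8) := by
  set C := cos (π / 8) / sin (π / 8) with hC
  have hC0 : 0 < C := div_pos cos_pi_div_eight_pos sin_pi_div_eight_pos
  have hC2 := two_le_cot_sq
  have hs : √(C ^ 2 - 1) ^ 2 = C ^ 2 - 1 := sq_sqrt (by linarith)
  have hpos : 0 < C + √(C ^ 2 - 1) := by positivity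
  rw [cosh_eq, exp_neg, mu, ← div_pow, ← hC, exp_log hpos]
  field_simp
  linarith

lemma mu_pos : 0 < mu := by
  have hC0 := div_pos cos_pi_div_eight_pos sin_pi_div_eight_pos
  refine log_pos ?_
  have hC2 := two_le_cot_sq
  rw [← div_pow]
  have : 1 < cos (π / 8) / sin (π / 8) := by nlinarith
  linarith [sqrt_nonneg ((cos (π / 8) / sin (π / 8)) ^ 2 - 1)]

lemma sinh_mu_pos : 0 < sinh mu := sinh_pos_iff.mpr mu_pos

end Constants

/-! ### The octagon in the Lorentz space `sl₂(ℝ)` -/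

section Geometry

open Real

lemma rotS_half_pi_mul : rotS (π / 2) * scaleU mu = (scaleU mu)⁻¹ * rotS (π / 2) := by
  have : (scaleU mu)⁻¹ = scaleU (-mu) := by
    rw [inv_eq_iff_mul_eq_one, ← scaleU_add, add_neg_cancel, scaleU_zero]
  rw [this]
  apply Subtype.ext
  change (rotS (π / 2)).1 * (scaleU mu).1 = (scaleU (-mu)).1 * (rotS (π / 2)).1
  ext i j
  fin_cases i <;> fin_cases j <;> simp [rotS, scaleU]

/-- The upper triangular matrix that carries `i` to the vertex of the octagon fixed by
`e^{μU} e^{3πS/8}`. -/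
noncomputable def vertexMap : SL(2, ℝ) :=
  let s := √(exp mu * tan (π / 8))
  ⟨!![s, -sinh mu * s; 0, s⁻¹], by
    have : 0 < tan (π / 8) := tan_pos_of_pos_of_lt_pi_div_two (by positivity) (by linarith [pi_pos])
    have : s ≠ 0 := by positivity
    rw [Matrix.det_fin_two_of]; field_simp; simp⟩

lemma scaleU_mul_rotS_mul_vertexMap :
    scaleU mu * rotS (3 * π / 8) * vertexMap = vertexMap * rotS (π / 8) := by
  have hs0 := sin_pi_div_eight_pos
  have hc0 := cos_pi_div_eight_pos
  have h3 : 3 * π / 8 = π / 2 - π / 8 := by ring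
  have hcosh := cosh_mu
  have ht : 0 < exp mu * tan (π / 8) := by rw [tan_eq_sin_div_cos]; positivity
  have hσ : √(exp mu * tan (π / 8)) ^ 2 = exp mu * (sin (π / 8) / cos (π / 8)) := by
    rw [sq_sqrt ht.le, tan_eq_sin_div_cos]
  have hσ0 : √(exp mu * tan (π / 8)) ≠ 0 := by positivity
  have hL : exp mu = cosh mu + sinh mu := (cosh_add_sinh mu).symm
  have hL' : exp (-mu) = cosh mu - sinh mu := (cosh_sub_sinh mu).symm
  have hCD : cosh mu ^ 2 - sinh mu ^ 2 = 1 := by rw [cosh_sq]; ring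
  have hC : cosh mu * sin (π / 8) = cos (π / 8) := by rw [hcosh]; field_simp
  apply Subtype.ext
  have e : vertexMap.1 = !![√(exp mu * tan (π / 8)), -sinh mu * √(exp mu * tan (π / 8));
      0, (√(exp mu * tan (π / 8)))⁻¹] := rfl
  change (scaleU mu).1 * (rotS (3 * π / 8)).1 * vertexMap.1 = vertexMap.1 * (rotS (π / 8)).1
  rw [e]
  generalize √(exp mu * tan (π / 8)) = σ at *
  rw [hL] at hσ
  simp only [scaleU, rotS, h3, cos_pi_div_two_sub, sin_pi_div_two_sub, hL, hL']
  generalize cosh mu = C at *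
  generalize sinh mu = D at *
  set c := cos (π / 8)
  set s := sin (π / 8)
  have hσ' : σ ^ 2 * c = (C + D) * s := by rw [hσ]; field_simp
  ext i j
  fin_cases i <;> fin_cases j <;> simp [Matrix.mul_apply, Fin.sum_univ_two]
  · linear_combination σ * hC
  · field_simp
    refine mul_left_cancel₀ hc0.ne' ?_
    linear_combination (-(C + D) * D * s - s + D * c) * hσ' +
      (C + D) * (s ^ 2 * hCD - (c + C * s) * hC - s * D * hC)
  · field_simp
    linear_combination (C - D) * hσ' + s * hCD
  · field_simp
    linear_combination (C - D) * D * hσ' + D * s * hCD + hC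

lemma scaleU_mul_rotS_pow : (scaleU mu * rotS (3 * π / 8)) ^ 8 = rotS π := by
  have h : scaleU mu * rotS (3 * π / 8) = vertexMap * rotS (π / 8) * vertexMap⁻¹ :=
    eq_mul_inv_of_mul_eq scaleU_mul_rotS_mul_vertexMap
  have h8 : rotS (π / 8) ^ 8 = rotS π := by
    have : ∀ n : ℕ, rotS (π / 8) ^ n = rotS (n * (π / 8)) := by
      intro n
      induction n with
      | zero => simp [rotS_zero]
      | succ n ih => rw [pow_succ, ih, ← rotS_add]; congr 1; push_cast; ring
    rw [this]; congr 1; push_cast; ring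
  have hc : rotS π = -1 := by
    ext i j; fin_cases i <;> fin_cases j <;> simp [rotS]
  rw [h, conj_pow, h8, hc]
  simp

lemma rotS_neg_two_pi : rotS (-(2 * π)) = 1 := by
  ext i j; fin_cases i <;> fin_cases j <;> simp [rotS]

/-- The element of `sl₂(ℝ)` that is the outer unit normal, for the Lorentz form, to the geodesic
through a side of the octagon about `i`, rotated by `e^{tS}`; `t = 0` belongs to the side through
which `e^{μU}` moves the octagon. -/
noncomputable def sideVector (t : ℝ) : Matrix (Fin 2) (Fin 2) ℝ :=
  (rotS t).1 * !![0, exp mu; exp (-mu), 0] * (rotS (-t)).1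

lemma sideVector_eq (t : ℝ) : sideVector t =
    !![2 * cosh mu * sin t * cos t, cos t ^ 2 * exp mu - sin t ^ 2 * exp (-mu);
      cos t ^ 2 * exp (-mu) - sin t ^ 2 * exp mu, -(2 * cosh mu * sin t * cos t)] := by
  rw [cosh_eq]
  ext i j
  fin_cases i <;> fin_cases j <;>
    simp [sideVector, rotS, Matrix.mul_apply, Fin.sum_univ_two] <;> ring

lemma sideVector_conj_rotS (s t : ℝ) :
    (rotS s).1 * sideVector t * (rotS (-s)).1 = sideVector (s + t) := by
  rw [sideVector, sideVector, rotS_add, show -(s + t) = -t + -s by ring, rotS_add]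
  simp [mul_assoc]

/-- The translation `e^{μU}` is the reflection in the side at `t = 0` after the reflection
`t ↦ π/2 - t` of the octagon. -/
lemma sideVector_conj_scaleU (t : ℝ) :
    (scaleU mu).1 * sideVector (π / 2 - t) * (scaleU (-mu)).1 = sideVector t +
      (4 * cosh mu ^ 2 * sin t ^ 2 - 2) • sideVector 0 := by
  have h1 : exp mu * exp (-mu) = 1 := by rw [← exp_add]; simp
  have h2 := sin_sq_add_cos_sq t
  simp only [sideVector_eq, cos_pi_div_two_sub, sin_pi_div_two_sub, cosh_eq]
  ext i j
  fin_cases i <;> fin_cases j <;>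
    simp [scaleU, Matrix.mul_apply, Fin.sum_univ_two]
  all_goals generalize exp mu = L at *
  all_goals generalize exp (-mu) = K at *
  all_goals generalize sin t = s at *
  all_goals generalize cos t = c at *
  · linear_combination (L + K) * c * s * h1
  · linear_combination (-c ^ 2 * L - 2 * s ^ 2 * L - s ^ 2 * K) * h1 - 2 * L * h2
  · linear_combination (-c ^ 2 * K - 2 * s ^ 2 * K - s ^ 2 * L) * h1 - 2 * K * h2
  · linear_combination (L + K) * c * s * h1

/-- The Lorentz product, up to a positive factor, with the vector `S` of the point `i`. -/
def lorentzProd (X : Matrix (Fin 2) (Fin 2) ℝ) : ℝ := X 1 0 - X 0 1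

lemma lorentzProd_sideVector_neg (t : ℝ) : lorentzProd (sideVector t) < 0 := by
  have h : lorentzProd (sideVector t) = -(2 * sinh mu) * (sin t ^ 2 + cos t ^ 2) := by
    rw [sideVector_eq, lorentzProd, sinh_eq]
    simp only [Matrix.of_apply, Matrix.cons_val', Matrix.cons_val_zero, Matrix.cons_val_one,
      Matrix.cons_val_fin_one]
    ring
  rw [h, sin_sq_add_cos_sq]
  linarith [sinh_mu_pos]

lemma cosh_dist_smul_I (γ : SL(2, ℝ)) :
    cosh (dist (γ • UpperHalfPlane.I) UpperHalfPlane.I)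
      = (γ 0 0 ^ 2 + γ 0 1 ^ 2 + γ 1 0 ^ 2 + γ 1 1 ^ 2) / 2 := by
  have hdet : γ 0 0 * γ 1 1 - γ 0 1 * γ 1 0 = 1 := by rw [← Matrix.det_fin_two, γ.2]
  have h := UpperHalfPlane.coe_specialLinearGroup_apply γ UpperHalfPlane.I
  rw [UpperHalfPlane.coe_I] at h
  generalize hw : γ • UpperHalfPlane.I = w at *
  generalize γ 0 0 = a at *
  generalize γ 0 1 = b at *
  generalize γ 1 0 = c at *
  generalize γ 1 1 = d at *
  have hne : c ^ 2 + d ^ 2 ≠ 0 := by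
    intro h0
    have hc : c = 0 := by nlinarith [sq_nonneg c, sq_nonneg d]
    have hd : d = 0 := by nlinarith [sq_nonneg c, sq_nonneg d]
    simp [hc, hd] at hdet
  have hre : w.re = (a * c + b * d) / (c ^ 2 + d ^ 2) := by
    have := congrArg Complex.re h
    rw [Complex.div_re] at this
    simp [Complex.normSq_apply] at this
    rw [this, ← add_div, show d * d + c * c = c ^ 2 + d ^ 2 by ring, add_comm]
  have him : w.im = 1 / (c ^ 2 + d ^ 2) := by
    have := congrArg Complex.im h
    rw [Complex.div_im] at this
    simp [Complex.normSq_apply] at this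
    rw [this, ← sub_div, show d * d + c * c = c ^ 2 + d ^ 2 by ring, hdet]
  rw [UpperHalfPlane.cosh_dist', hre, him]
  simp only [UpperHalfPlane.I_re, UpperHalfPlane.I_im]
  field_simp
  linear_combination (-(a * d - b * c) - 1) * hdet

/-- If a geodesic carried along by `γ` from a side of the octagon about `i` separates `γ i` from `i`,
then `γ i` is farther from `i` than `μ`. -/
lemma mu_lt_dist_of_lorentzProd_pos {γ : SL(2, ℝ)} {t : ℝ}
    (h : 0 < lorentzProd (γ.1 * sideVector t * (γ⁻¹).1)) :
    mu < dist (γ • UpperHalfPlane.I) UpperHalfPlane.I := by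
  rw [← abs_of_pos mu_pos, ← abs_of_nonneg (dist_nonneg (x := γ • UpperHalfPlane.I)), ← cosh_lt_cosh,
    dist_comm, ← dist_smul γ⁻¹, inv_smul_smul, cosh_dist_smul_I]
  have hdet : γ 0 0 * γ 1 1 - γ 0 1 * γ 1 0 = 1 := by rw [← Matrix.det_fin_two, γ.2]
  have hC := cosh_pos mu
  have hD := sinh_mu_pos
  have hCD : cosh mu ^ 2 - sinh mu ^ 2 = 1 := by rw [cosh_sq]; ring
  have h1 := sin_sq_add_cos_sq t
  have hL : exp mu = cosh mu + sinh mu := (cosh_add_sinh mu).symm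
  have hL' : exp (-mu) = cosh mu - sinh mu := (cosh_sub_sinh mu).symm
  rw [sideVector_eq, hL, hL'] at h
  simp only [lorentzProd, Matrix.SpecialLinearGroup.coe_inv, Matrix.adjugate_fin_two,
    Matrix.mul_apply, Fin.sum_univ_two, Matrix.of_apply, Matrix.cons_val', Matrix.cons_val_zero,
    Matrix.cons_val_one, Matrix.cons_val_fin_one] at h ⊢
  generalize γ 0 0 = a at *
  generalize γ 0 1 = b at *
  generalize γ 1 0 = c at *
  generalize γ 1 1 = d at *
  generalize cosh mu = C at *
  generalize sinh mu = D at *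
  generalize sin t = s at *
  generalize cos t = v at *
  set k := (a ^ 2 + b ^ 2 + c ^ 2 + d ^ 2) / 2 with hk
  set α := (b ^ 2 + d ^ 2 - a ^ 2 - c ^ 2) / 2 with hα
  set β := a * b + c * d with hβ
  have hαβ : α ^ 2 + β ^ 2 = k ^ 2 - 1 := by
    rw [hα, hβ, hk]
    linear_combination (-(a * d - b * c) - 1) * hdet
  have hN : 0 < 2 * (α * (C * (v ^ 2 - s ^ 2)) + β * (C * (2 * s * v))) - 2 * D * k := by
    refine h.trans_eq ?_
    rw [hα, hβ, hk]
    linear_combination -D * (a ^ 2 + b ^ 2 + c ^ 2 + d ^ 2) * h1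
  -- the Cauchy-Schwarz inequality for `(α, β)` and the unit vector `(cos 2t, sin 2t)`
  set X := α * (v ^ 2 - s ^ 2) + β * (2 * s * v) with hX
  have hX2 : X ^ 2 ≤ k ^ 2 - 1 := by
    have : X ^ 2 + (α * (2 * s * v) - β * (v ^ 2 - s ^ 2)) ^ 2 = k ^ 2 - 1 := by
      rw [← hαβ, hX]
      linear_combination (α ^ 2 + β ^ 2) * (s ^ 2 + v ^ 2 + 1) * h1
    nlinarith [sq_nonneg (α * (2 * s * v) - β * (v ^ 2 - s ^ 2))]
  have hk0 : 0 ≤ k := by positivity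
  have hDX : D * k < C * X := by rw [hX]; linarith
  have hsq : (D * k) ^ 2 < (C * X) ^ 2 := pow_lt_pow_left₀ hDX (by positivity) two_ne_zero
  have hCk : C ^ 2 < k ^ 2 := by nlinarith [mul_le_mul_of_nonneg_left hX2 (sq_nonneg C)]
  have := lt_of_pow_lt_pow_left₀ 2 hk0 hCk
  rw [hk] at this
  linarith

end Geometry

/-! ### The phase of a rotation -/

section Phase

open Real

/-- For `|t| < π` the automorphy factor `cos t - z sin t` avoids the cut of the principal
logarithm. -/
lemma rotS_denom_mem_slitPlane {t : ℝ} (ht : |t| < π) (z : ℍ) :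
    -(sin t : ℂ) * (z : ℂ) + (cos t : ℂ) ∈ Complex.slitPlane := by
  rw [abs_lt] at ht
  rw [Complex.mem_slitPlane_iff]
  by_cases h : sin t = 0
  · have : t = 0 := (sin_eq_zero_iff_of_lt_of_lt ht.1 ht.2).mp h
    simp [this]
  · right
    simp [-Complex.ofReal_sin, -Complex.ofReal_cos, h, z.im_ne_zero]

lemma integral_im_rotS {t : ℝ} (ht : |t| < π) (z : ℍ) :
    ∫ r in (0 : ℝ)..t, (rotS r • z : ℍ).im =
      -Complex.arg (-(sin t : ℂ) * (z : ℂ) + (cos t : ℂ)) := by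
  have hderiv : ∀ r ∈ Set.uIcc 0 t, HasDerivAt
      (fun r : ℝ => -Complex.arg (-(sin r : ℂ) * (z : ℂ) + (cos r : ℂ))) (rotS r • z : ℍ).im r := by
    intro r hr
    have hr' : |r| < π := by
      rw [Set.mem_uIcc] at hr
      rw [abs_lt] at ht ⊢
      rcases hr with hr | hr <;> constructor <;> linarith [pi_pos]
    have hs : HasDerivAt (fun r : ℝ => ((sin r : ℝ) : ℂ)) ((cos r : ℝ) : ℂ) r :=
      (hasDerivAt_sin r).ofReal_comp
    have hc : HasDerivAt (fun r : ℝ => ((cos r : ℝ) : ℂ)) ((-sin r : ℝ) : ℂ) r :=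
      (hasDerivAt_cos r).ofReal_comp
    have h1 := ((hs.neg.mul_const (z : ℂ)).add hc).clog_real (rotS_denom_mem_slitPlane hr' z)
    have h2 := (Complex.imCLM.hasFDerivAt.comp_hasDerivAt r h1).neg
    have h3 : (rotS r • z : ℍ).im = ((rotS r • z : ℍ) : ℂ).im := rfl
    simp only [Complex.log_im, Function.comp_def, Complex.imCLM_apply] at h2
    refine HasDerivAt.congr_deriv
      (f := fun r : ℝ => -Complex.arg (-(sin r : ℂ) * (z : ℂ) + (cos r : ℂ))) h2 ?_
    rw [h3, coe_rotS_smul, ← Complex.neg_im, ← neg_div]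
    congr 2
    push_cast
    ring
  rw [intervalIntegral.integral_eq_sub_of_hasDerivAt hderiv
    ((continuous_im_rotS z).intervalIntegrable _ _)]
  simp

lemma phaseS_eq (B : ℝ) {t : ℝ} (ht : |t| < π) (z : ℍ) :
    phaseS B t z = Complex.exp (-(2 * Complex.I * B *
      (Complex.arg (-(sin t : ℂ) * (z : ℂ) + (cos t : ℂ)) : ℝ))) := by
  rw [phaseS, integral_im_rotS ht]
  push_cast
  ring_nf

lemma norm_phaseS (B t : ℝ) (z : ℍ) : ‖phaseS B t z‖ = 1 := by
  rw [phaseS, Complex.norm_exp]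
  simp

lemma abs_lt_pi_of_nonneg {t : ℝ} (h0 : 0 ≤ t) (h : t < π) : |t| < π := by rwa [abs_of_nonneg h0]

lemma phaseS_pi (B : ℝ) (z : ℍ) : phaseS B π z = Complex.exp (2 * π * Complex.I * B) := by
  have h : |π / 2| < π := abs_lt_pi_of_nonneg (by positivity) (by linarith [pi_pos])
  have hz : Complex.arg (z : ℂ) ≠ π := by
    rw [Ne, Complex.arg_eq_pi_iff]
    exact fun h => z.im_ne_zero h.2
  rw [show π = π / 2 + π / 2 by ring, phaseS_add, phaseS_eq B h, phaseS_eq B h, ← Complex.exp_add,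
    coe_rotS_smul]
  simp only [sin_pi_div_two, cos_pi_div_two, Complex.ofReal_one, Complex.ofReal_zero, zero_mul,
    zero_add, add_zero, neg_mul, one_mul, ← neg_div, div_neg, neg_neg]
  rw [one_div, Complex.arg_inv, if_neg hz,
    Complex.arg_neg_eq_arg_sub_pi_of_im_pos z.im_pos]
  push_cast
  ring_nf

end Phase

/-! ### The octagon relation of the operators -/

section Operators

open Real

lemma expS_apply (B t : ℝ) (f : ℍ → ℂ) (z : ℍ) : expS B t f z = phaseS B t z * f (rotS t • z) := rfl

lemma expU_apply (m : ℝ) (f : ℍ → ℂ) (z : ℍ) : expU m f z = f (scaleU m • z) := rfl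

lemma expU_neg (m : ℝ) : expU (-m) = (expU m)⁻¹ := by
  rw [eq_inv_iff_mul_eq_one, ← expU_add, neg_add_cancel, expU_zero]

lemma expS_neg (B t : ℝ) : expS B (-t) = (expS B t)⁻¹ := by
  rw [eq_inv_iff_mul_eq_one, ← expS_add, neg_add_cancel, expS_zero]

lemma scaleU_neg (m : ℝ) : scaleU (-m) = (scaleU m)⁻¹ := by
  rw [eq_inv_iff_mul_eq_one, ← scaleU_add, neg_add_cancel, scaleU_zero]

lemma rotS_neg (t : ℝ) : rotS (-t) = (rotS t)⁻¹ := by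
  rw [eq_inv_iff_mul_eq_one, ← rotS_add, neg_add_cancel, rotS_zero]

lemma expS_pi_apply (B : ℝ) (f : ℍ → ℂ) : expS B π f = Complex.exp (2 * π * Complex.I * B) • f := by
  ext z
  have : rotS π • z = z := by
    apply UpperHalfPlane.ext
    rw [coe_rotS_smul]; simp
  rw [expS_apply, phaseS_pi, this]
  rfl

lemma expS_two_pi_apply (B : ℝ) (f : ℍ → ℂ) :
    expS B (2 * π) f = Complex.exp (4 * π * Complex.I * B) • f := by
  rw [two_mul, expS_add, LinearEquiv.mul_apply, expS_pi_apply, expS_pi_apply, smul_smul,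
    ← Complex.exp_add]
  ring_nf

/-- The operator form of `rotS_half_pi_mul`; no phase appears since `-z` and `-e^{2μ} z` have the
same argument. -/
lemma expS_half_pi_mul (B : ℝ) : expS B (π / 2) * (expU mu)⁻¹ = expU mu * expS B (π / 2) := by
  have h : |π / 2| < π := abs_lt_pi_of_nonneg (by positivity) (by linarith [pi_pos])
  rw [← expU_neg]
  ext f z
  simp only [LinearEquiv.mul_apply, expS_apply, expU_apply, ← mul_smul]
  rw [rotS_half_pi_mul, scaleU_neg, phaseS_eq B h, phaseS_eq B h, coe_scaleU_smul]
  simp only [sin_pi_div_two, cos_pi_div_two, Complex.ofReal_one, Complex.ofReal_zero, add_zero,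
    neg_mul, one_mul, ← mul_neg]
  rw [Complex.arg_real_mul _ (exp_pos _)]

/-- The operator `f ↦ f ∘ g`, without a phase. -/
noncomputable def pullback (g : SL(2, ℝ)) : (ℍ → ℂ) ≃ₗ[ℂ] (ℍ → ℂ) where
  toFun f z := f (g • z)
  invFun f z := f (g⁻¹ • z)
  map_add' f h := rfl
  map_smul' c f := rfl
  left_inv f := by ext z; simp
  right_inv f := by ext z; simp

lemma coe_vertexMap_smul (z : ℍ) :
    ((vertexMap • z : ℍ) : ℂ) = (exp mu * tan (π / 8) : ℝ) * (z - sinh mu) := by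
  have ht : 0 < exp mu * tan (π / 8) := by
    have := sin_pi_div_eight_pos
    have := cos_pi_div_eight_pos
    rw [tan_eq_sin_div_cos]; positivity
  have h := mul_self_sqrt ht.le
  have h0 : √(exp mu * tan (π / 8)) ≠ 0 := by positivity
  rw [UpperHalfPlane.coe_specialLinearGroup_apply]
  have e : vertexMap.1 = !![√(exp mu * tan (π / 8)), -sinh mu * √(exp mu * tan (π / 8));
      0, (√(exp mu * tan (π / 8)))⁻¹] := rfl
  simp only [e, Matrix.of_apply, Matrix.cons_val', Matrix.cons_val_zero, Matrix.cons_val_one,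
    Matrix.cons_val_fin_one, Algebra.algebraMap_self, RingHom.id_apply]
  generalize √(exp mu * tan (π / 8)) = σ at *
  rw [← h]
  have h0' : (σ : ℂ) ≠ 0 := by exact_mod_cast h0
  push_cast
  field_simp
  ring

/-- `scaleU_mul_rotS_mul_vertexMap` at the level of phases: the two automorphy factors differ by the
positive factor `e^μ`. -/
lemma phaseS_vertexMap (B : ℝ) (z : ℍ) :
    phaseS B (3 * π / 8) (vertexMap • z) = phaseS B (π / 8) z := by
  have hs0 := sin_pi_div_eight_pos
  have hc0 := cos_pi_div_eight_pos
  rw [phaseS_eq B (abs_lt_pi_of_nonneg (by positivity) (by linarith [pi_pos])),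
    phaseS_eq B (abs_lt_pi_of_nonneg (by positivity) (by linarith [pi_pos])), coe_vertexMap_smul,
    ← Complex.arg_real_mul (-(sin (π / 8) : ℂ) * (z : ℂ) + (cos (π / 8) : ℂ)) (exp_pos mu)]
  congr 6
  rw [show 3 * π / 8 = π / 2 - π / 8 by ring, cos_pi_div_two_sub, sin_pi_div_two_sub,
    tan_eq_sin_div_cos]
  have hC : cosh mu * sin (π / 8) = cos (π / 8) := by rw [cosh_mu]; field_simp
  have hL : exp mu = cosh mu + sinh mu := (cosh_add_sinh mu).symm
  have hCD : cosh mu ^ 2 - sinh mu ^ 2 = 1 := by rw [cosh_sq]; ring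
  have key : exp mu * sin (π / 8) * sinh mu + sin (π / 8) = exp mu * cos (π / 8) := by
    rw [← hC, hL]; linear_combination sin (π / 8) * (-hCD)
  have hc0' : (cos (π / 8) : ℂ) ≠ 0 := by exact_mod_cast hc0.ne'
  have key' := congrArg (Complex.ofReal) key
  push_cast [-Complex.ofReal_sin, -Complex.ofReal_cos, -Complex.ofReal_exp,
    -Complex.ofReal_sinh] at key' ⊢
  field_simp
  linear_combination key'

lemma expS_mul_expU_pow (B : ℝ) : (expS B (3 * π / 8) * expU mu) ^ 8 = expS B π := by
  have hconj : pullback vertexMap * (expS B (3 * π / 8) * expU mu) =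
      expS B (π / 8) * pullback vertexMap := by
    ext f z
    change phaseS B (3 * π / 8) (vertexMap • z) * f (scaleU mu • rotS (3 * π / 8) • vertexMap • z)
      = phaseS B (π / 8) z * f (vertexMap • rotS (π / 8) • z)
    rw [phaseS_vertexMap, ← mul_smul, ← mul_smul, scaleU_mul_rotS_mul_vertexMap, mul_smul]
  have h8 : expS B (π / 8) ^ 8 = expS B π := by
    have : ∀ n : ℕ, expS B (π / 8) ^ n = expS B (n * (π / 8)) := by
      intro n
      induction n with
      | zero => simp [expS_zero]
      | succ n ih => rw [pow_succ, ih, ← expS_add]; congr 1; push_cast; ring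
    rw [this]; congr 1; push_cast; ring
  have hcomm : expS B π * pullback vertexMap = pullback vertexMap * expS B π := by
    ext f z
    simp only [LinearEquiv.mul_apply, expS_pi_apply, map_smul]
  rw [eq_inv_mul_of_mul_eq hconj, ← mul_assoc]
  have := conj_pow (i := 8) (a := (pullback vertexMap)⁻¹) (b := expS B (π / 8))
  rw [inv_inv] at this
  rw [this, h8, mul_assoc, hcomm, inv_mul_cancel_left]

/-- The inverses of the operators `γ̂_{j+1}`, for all `j : ℤ`. The inverses act from the left on
supports and so multiply in the same order as the elements of `SL(2, ℝ)`. -/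
noncomputable def magneticSide (B : ℝ) : ℤ → ((ℍ → ℂ) ≃ₗ[ℂ] (ℍ → ℂ)) :=
  rotatedConj (fun t => expS B (-t)) (expU mu)⁻¹

lemma magneticSide_add_four (B : ℝ) (j : ℤ) : magneticSide B (j + 4) = (magneticSide B j)⁻¹ := by
  refine rotatedConj_add_four (fun s t => by rw [neg_add, expS_add]) ?_ j
  simp only [expS_neg, inv_inv]
  have h := expS_half_pi_mul B
  rw [mul_inv_eq_iff_eq_mul] at h
  rw [← mul_inv_rev, inv_eq_iff_mul_eq_one, ← mul_assoc, ← h, mul_inv_cancel]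

lemma octagonRelator_magneticSide (B : ℝ) :
    octagonRelator (magneticSide B) = expS B (2 * π) := by
  have := octagonRelator_rotatedConj (r := fun t => expS B (-t)) (u := (expU mu)⁻¹)
    (fun s t => by rw [neg_add, expS_add]) (by
      simp only [expS_neg]
      rw [← mul_inv_rev, inv_pow, expS_mul_expU_pow])
  rwa [neg_neg] at this

lemma magneticSide_natCast (B : ℝ) (a : Fin 4) :
    magneticSide B (a : ℕ) = (magneticGen B a)⁻¹ := by
  rw [magneticGen, magneticSide, rotatedConj, mul_inv_rev, mul_inv_rev, ← expS_neg, ← expS_neg]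
  simp [angle, mul_assoc]

/-- The elements `γ_{j+1}` for all `j : ℤ`; `γ_{j+1}` moves the octagon about `i` across its side
`j`. -/
noncomputable def fuchsianSide : ℤ → SL(2, ℝ) := rotatedConj rotS (scaleU mu)

lemma fuchsianSide_add_four (j : ℤ) : fuchsianSide (j + 4) = (fuchsianSide j)⁻¹ :=
  rotatedConj_add_four rotS_add rotS_half_pi_mul j

lemma octagonRelator_fuchsianSide :
    octagonRelator fuchsianSide = 1 := by
  rw [← rotS_neg_two_pi]
  exact octagonRelator_rotatedConj rotS_add scaleU_mul_rotS_pow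

lemma fuchsianSide_natCast (a : Fin 4) : fuchsianSide (a : ℕ) = fuchsianGen a := by
  simp [fuchsianSide, rotatedConj, fuchsianGen, angle]

lemma magneticGen_apply (B : ℝ) (a : Fin 4) (f : ℍ → ℂ) (z : ℍ) :
    magneticGen B a f z = phaseFactor (magneticGen B a) z * f (fuchsianGen a • z) := by
  simp only [phaseFactor, magneticGen, fuchsianGen, LinearEquiv.mul_apply, expS_apply, expU_apply,
    mul_smul, mul_one, mul_assoc]

lemma norm_phaseFactor_magneticGen (B : ℝ) (a : Fin 4) (z : ℍ) :
    ‖phaseFactor (magneticGen B a) z‖ = 1 := by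
  simp only [phaseFactor, magneticGen, LinearEquiv.mul_apply, expS_apply, expU_apply, norm_mul,
    norm_phaseS, mul_one]

end Operators

/-! ### The factor of automorphy -/

section Automorphy

lemma exists_fuchsian_of_mem {B : ℝ} {E : (ℍ → ℂ) ≃ₗ[ℂ] (ℍ → ℂ)}
    (hE : E ∈ magneticFuchsianGroup B) :
    ∃ γ ∈ fuchsianGroup, ∀ z : ℍ, ‖phaseFactor E z‖ = 1 ∧
      ∀ f : ℍ → ℂ, E f z = phaseFactor E z * f (γ • z) := by
  induction hE using Subgroup.closure_induction with
  | mem E hE =>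
    obtain ⟨a, rfl⟩ := hE
    exact ⟨fuchsianGen a, Subgroup.subset_closure ⟨a, rfl⟩, fun z =>
      ⟨norm_phaseFactor_magneticGen B a z, fun f => magneticGen_apply B a f z⟩⟩
  | one => exact ⟨1, one_mem _, fun z => by simp [phaseFactor]⟩
  | mul E F _ _ hE hF =>
    obtain ⟨γ, hγ, h⟩ := hE
    obtain ⟨δ, hδ, h'⟩ := hF
    have key : ∀ (f : ℍ → ℂ) z, (E * F) f z =
        phaseFactor E z * phaseFactor F (γ • z) * f ((δ * γ) • z) := fun f z => by
      rw [LinearEquiv.mul_apply, (h z).2, (h' _).2, mul_smul, mul_assoc]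
    have hphase : ∀ z, phaseFactor (E * F) z = phaseFactor E z * phaseFactor F (γ • z) :=
      fun z => by rw [phaseFactor, key, mul_one]
    exact ⟨δ * γ, mul_mem hδ hγ, fun z => ⟨by rw [hphase, norm_mul, (h z).1, (h' _).1, mul_one],
      fun f => by rw [key, hphase]⟩⟩
  | inv E _ hE =>
    obtain ⟨γ, hγ, h⟩ := hE
    have hne : ∀ z, phaseFactor E z ≠ 0 := fun z h0 => by simpa [h0] using (h z).1
    have key : ∀ (f : ℍ → ℂ) z, E⁻¹ f z = (phaseFactor E (γ⁻¹ • z))⁻¹ * f (γ⁻¹ • z) := fun f z => by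
      have h1 := (h (γ⁻¹ • z)).2 (E⁻¹ f)
      rw [smul_inv_smul, ← LinearEquiv.mul_apply, mul_inv_cancel, LinearEquiv.coe_one, id] at h1
      rw [h1, inv_mul_cancel_left₀ (hne _)]
    have hphase : ∀ z, phaseFactor E⁻¹ z = (phaseFactor E (γ⁻¹ • z))⁻¹ :=
      fun z => by rw [phaseFactor, key, mul_one]
    exact ⟨γ⁻¹, inv_mem hγ, fun z => ⟨by rw [hphase, norm_inv, (h _).1, inv_one],
      fun f => by rw [key, hphase]⟩⟩

end Automorphy

/-! ### The surface group -/

section OctagonGroup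

variable {G H : Type*} [Group G] [Group H]

/-- The sequence `y 0, …, y 3, (y 0)⁻¹, …, (y 3)⁻¹`, continued with period `8`. -/
def signedGen (y : Fin 4 → G) (j : ℤ) : G :=
  if (j / 4) % 2 = 0 then y (Fin.ofNat 4 (j % 4).toNat) else (y (Fin.ofNat 4 (j % 4).toNat))⁻¹

lemma signedGen_add_four (y : Fin 4 → G) (j : ℤ) :
    signedGen y (j + 4) = (signedGen y j)⁻¹ := by
  have h1 : (j + 4) % 4 = j % 4 := by omega
  have h2 : (j + 4) / 4 = j / 4 + 1 := by omega
  rw [signedGen, signedGen, h1, h2]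
  by_cases h : (j / 4) % 2 = 0
  · rw [if_neg (by omega), if_pos h]
  · rw [if_pos (by omega), if_neg h, inv_inv]

lemma signedGen_natCast (y : Fin 4 → G) (a : Fin 4) : signedGen y (a : ℕ) = y a := by
  fin_cases a <;> simp [signedGen]
  rfl

lemma map_signedGen (f : G →* H) (y : Fin 4 → G) (j : ℤ) :
    f (signedGen y j) = signedGen (fun a => f (y a)) j := by
  simp only [signedGen]
  split_ifs <;> simp

lemma signedGen_eq {s : ℤ → G} (hs : ∀ j, s (j + 4) = (s j)⁻¹) :
    signedGen (fun a : Fin 4 => s (a : ℕ)) = s :=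
  eq_of_add_four (signedGen_add_four _) hs (signedGen_natCast _)

lemma octagonRelator_signedGen (y : Fin 4 → G) : octagonRelator (signedGen y) =
    y 0 * y 3 * (y 2)⁻¹ * y 1 * (y 0)⁻¹ * (y 3)⁻¹ * y 2 * (y 1)⁻¹ := rfl

/-- The fundamental group of the closed surface of genus two, presented by the octagon with opposite
sides identified. -/
abbrev OctagonGroup : Type :=
  PresentedGroup {octagonRelator (signedGen (FreeGroup.of : Fin 4 → FreeGroup (Fin 4)))}

/-- The element of `OctagonGroup` that leads across the side `j` of the base tile. -/
def octagonSide : ℤ → OctagonGroup := signedGen PresentedGroup.of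

lemma octagonRelator_octagonSide : octagonRelator octagonSide = 1 := by
  have h := PresentedGroup.one_of_mem (Set.mem_singleton
    (octagonRelator (signedGen (FreeGroup.of : Fin 4 → FreeGroup (Fin 4)))))
  rw [map_octagonRelator] at h
  simp only [map_signedGen] at h
  exact h

lemma closure_range_octagonSide : Subgroup.closure (Set.range octagonSide) = ⊤ := by
  rw [eq_top_iff, ← PresentedGroup.closure_range_of]
  refine Subgroup.closure_mono ?_
  rintro _ ⟨a, rfl⟩
  exact ⟨(a : ℕ), signedGen_natCast _ a⟩

/-- The homomorphism given by a sequence that satisfies the octagon relation. -/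
def octagonHom (s : ℤ → H) (hs : ∀ j, s (j + 4) = (s j)⁻¹) (hrel : octagonRelator s = 1) :
    OctagonGroup →* H :=
  PresentedGroup.toGroup (f := fun a : Fin 4 => s (a : ℕ)) (by
    rintro _ rfl
    rw [map_octagonRelator]
    simpa only [map_signedGen, FreeGroup.lift_apply_of, signedGen_eq hs] using hrel)

lemma octagonHom_of {s : ℤ → H} (hs : ∀ j, s (j + 4) = (s j)⁻¹) (hrel : octagonRelator s = 1)
    (a : Fin 4) : octagonHom s hs hrel (.of a) = s (a : ℕ) :=
  PresentedGroup.toGroup.of _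

lemma octagonHom_octagonSide {s : ℤ → H} (hs : ∀ j, s (j + 4) = (s j)⁻¹)
    (hrel : octagonRelator s = 1) (j : ℤ) : octagonHom s hs hrel (octagonSide j) = s j := by
  rw [octagonSide, map_signedGen]
  simp only [octagonHom_of, signedGen_eq hs]

/-- The homomorphism to `SL(2, ℝ)` whose image is the Fuchsian group. -/
noncomputable def toFuchsian : OctagonGroup →* SL(2, ℝ) :=
  octagonHom fuchsianSide fuchsianSide_add_four octagonRelator_fuchsianSide

lemma toFuchsian_of (a : Fin 4) : toFuchsian (.of a) = fuchsianGen a := by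
  rw [toFuchsian, octagonHom_of, fuchsianSide_natCast]

open Real in
/-- The side vectors of the tile across the side `j` are the mirror images in that side of the side
vectors of the base tile. -/
lemma sideVector_conj_fuchsianSide (j k : ℤ) :
    (fuchsianSide j).1 * sideVector (((2 * j + 4 - k : ℤ) : ℝ) * π / 8) * ((fuchsianSide j)⁻¹).1 =
      sideVector (k * π / 8) +
        (4 * cosh mu ^ 2 * sin (((k - j : ℤ) : ℝ) * π / 8) ^ 2 - 2) • sideVector (j * π / 8) := by
  have hinv : (fuchsianSide j)⁻¹ = rotS (j * π / 8) * scaleU (-mu) * rotS (-(j * π / 8)) := by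
    rw [fuchsianSide, rotatedConj, mul_inv_rev, mul_inv_rev, ← rotS_neg, ← rotS_neg, ← scaleU_neg,
      neg_neg, mul_assoc]
  have e : (((2 * j + 4 - k : ℤ) : ℝ) * π / 8)
      = j * π / 8 + (π / 2 - (((k - j : ℤ) : ℝ) * π / 8)) := by push_cast; ring
  have e2 : (k : ℝ) * π / 8 = j * π / 8 + ((k - j : ℤ) : ℝ) * π / 8 := by push_cast; ring
  have hRR : (rotS (-(j * π / 8))).1 * (rotS (j * π / 8)).1 = 1 := by
    rw [← Matrix.SpecialLinearGroup.coe_mul, ← rotS_add]; simp [rotS_zero]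
  rw [hinv, fuchsianSide, rotatedConj, e, ← sideVector_conj_rotS]
  have e3 := sideVector_conj_scaleU (((k - j : ℤ) : ℝ) * π / 8)
  rw [e2, ← sideVector_conj_rotS (j * π / 8) (((k - j : ℤ) : ℝ) * π / 8),
    show sideVector ((j : ℝ) * π / 8) = sideVector (j * π / 8 + 0) by rw [add_zero],
    ← sideVector_conj_rotS (j * π / 8) 0, ← smul_mul_assoc, ← mul_smul_comm, ← add_mul, ← mul_add,
    ← e3]
  simp only [Matrix.SpecialLinearGroup.coe_mul]
  simp only [mul_assoc]
  rw [← mul_assoc (rotS (-(j * π / 8))).1 (rotS (j * π / 8)).1, hRR, one_mul,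
    ← mul_assoc (rotS (-(j * π / 8))).1 (rotS (j * π / 8)).1, hRR, one_mul]

open Real in
/-- `OctagonGroup` acts freely on the orbit of `i`, with a uniform separation of the points. -/
lemma mu_lt_dist_toFuchsian {g : OctagonGroup} (hg : g ≠ 1) :
    mu < dist (toFuchsian g • UpperHalfPlane.I) UpperHalfPlane.I := by
  have hC : 4 * cosh mu ^ 2 * sin (π / 8) ^ 2 = 4 * cos (π / 8) ^ 2 := by
    have := sin_pi_div_eight_pos
    rw [cosh_mu]; field_simp
  obtain ⟨j, hj⟩ := exists_pos_of_ne_one (x := octagonSide)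
    (χ := octagonHom (fun _ => -1) (by simp) (by simp [octagonRelator]))
    (ν := fun g j => lorentzProd ((toFuchsian g).1 * sideVector (j * π / 8) *
      ((toFuchsian g)⁻¹).1))
    (a := fun d => 4 * cosh mu ^ 2 * sin ((d : ℝ) * π / 8) ^ 2 - 2)
    (signedGen_add_four _) octagonRelator_octagonSide closure_range_octagonSide
    (fun j => octagonHom_octagonSide _ _ j)
    (fun j => by simpa using lorentzProd_sideVector_neg _)
    (fun g j k => by
      have h : toFuchsian (octagonSide j) = fuchsianSide j := octagonHom_octagonSide _ _ j
      have h2 := sideVector_conj_fuchsianSide j k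
      rw [map_mul, h, mul_inv_rev, Matrix.SpecialLinearGroup.coe_mul,
        Matrix.SpecialLinearGroup.coe_mul]
      have h3 : (toFuchsian g).1 * (fuchsianSide j).1 *
          sideVector (((2 * j + 4 - k : ℤ) : ℝ) * π / 8) *
            (((fuchsianSide j)⁻¹).1 * ((toFuchsian g)⁻¹).1) =
          (toFuchsian g).1 * ((fuchsianSide j).1 *
          sideVector (((2 * j + 4 - k : ℤ) : ℝ) * π / 8) *
            ((fuchsianSide j)⁻¹).1) * ((toFuchsian g)⁻¹).1 := by simp only [mul_assoc]
      rw [h3, h2]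
      simp only [lorentzProd, mul_add, add_mul, Matrix.add_apply, Matrix.smul_apply, mul_smul_comm,
        smul_mul_assoc, smul_eq_mul]
      ring)
    (by simp)
    (by
      rw [Int.cast_one, one_mul, hC, cos_sq_pi_div_eight]
      ring)
    (by
      rw [Int.cast_neg, Int.cast_one, neg_mul, one_mul, neg_div, sin_neg, neg_sq, hC,
        cos_sq_pi_div_eight]
      ring)
    (fun d hd hd' => by
      have hd2 : (2 : ℝ) ≤ d := by exact_mod_cast hd
      have hd6 : (d : ℝ) ≤ 6 := by exact_mod_cast hd'
      have hcos : cos (2 * (d * π / 8)) ≤ 0 :=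
        cos_nonpos_of_pi_div_two_le_of_le (by nlinarith [pi_pos]) (by nlinarith [pi_pos])
      have hC2 := two_le_cot_sq
      rw [← cosh_mu] at hC2
      rw [Int.cast_neg, neg_mul, neg_div, sin_neg, neg_sq, sin_sq_eq_half_sub]
      nlinarith)
    hg
  exact mu_lt_dist_of_lorentzProd_pos hj

end OctagonGroup

/-! ### Smooth functions on the upper half-plane -/

section Smoothness

open Real

/-- Smoothness over `ℝ`, for functions on the upper half-plane. -/
def IsSmooth (f : ℍ → ℂ) : Prop := ContMDiff 𝓘(ℝ, ℂ) 𝓘(ℝ, ℂ) ∞ f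

lemma isSmooth_coe : IsSmooth ((↑) : ℍ → ℂ) := fun _ => contMDiffAt_extChartAt

lemma IsSmooth.comp_smul {f : ℍ → ℂ} (hf : IsSmooth f) (γ : SL(2, ℝ)) :
    IsSmooth fun z => f (γ • z) := by
  refine ContMDiff.comp hf ?_
  intro z
  refine contMDiffAt_iff_target.mpr ⟨(continuous_const_smul γ).continuousAt, ?_⟩
  have h : ContMDiffAt 𝓘(ℝ, ℂ) 𝓘(ℝ, ℂ) ∞ (fun w : ℍ => ((γ • w : ℍ) : ℂ)) z := by
    simp only [UpperHalfPlane.coe_specialLinearGroup_apply]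
    have h0 : ((algebraMap ℝ ℝ (γ 1 0) : ℝ) : ℂ) * (z : ℂ) + ((algebraMap ℝ ℝ (γ 1 1) : ℝ) : ℂ) ≠ 0 :=
      UpperHalfPlane.denom_ne_zero (γ : GL (Fin 2) ℝ) z
    have h1 : ContDiffAt ℝ ∞ (fun w : ℂ => (((algebraMap ℝ ℝ (γ 0 0) : ℝ) : ℂ) * w +
        ((algebraMap ℝ ℝ (γ 0 1) : ℝ) : ℂ)) / (((algebraMap ℝ ℝ (γ 1 0) : ℝ) : ℂ) * w +
        ((algebraMap ℝ ℝ (γ 1 1) : ℝ) : ℂ))) (z : ℂ) := by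
      simp only [div_eq_mul_inv]
      exact ContDiffAt.mul (by fun_prop) (ContDiffAt.inv (by fun_prop) h0)
    exact h1.contMDiffAt.comp z (isSmooth_coe z)
  simpa using! h

lemma isSmooth_phaseS (B : ℝ) {t : ℝ} (ht : |t| < π) : IsSmooth (phaseS B t) := by
  intro z
  have h : phaseS B t = (fun w : ℂ => Complex.exp (-(2 * Complex.I * B *
      (Complex.imCLM (Complex.log (-(sin t : ℂ) * w + (cos t : ℂ))) : ℝ)))) ∘
        ((↑) : ℍ → ℂ) := by
    funext w
    rw [phaseS_eq B ht]
    simp [Complex.log_im]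
  rw [h]
  have h1 : ContDiffAt ℝ ∞ (fun w : ℂ => Complex.log (-(sin t : ℂ) * w + (cos t : ℂ))) z :=
    ((Complex.contDiffAt_log (rotS_denom_mem_slitPlane ht z)).restrict_scalars ℝ).fun_comp (z : ℂ)
      (by fun_prop : ContDiffAt ℝ ∞ (fun w : ℂ => -(sin t : ℂ) * w + (cos t : ℂ)) z)
  have h2 : ContDiffAt ℝ ∞ (fun w : ℂ => ((Complex.imCLM (Complex.log
      (-(sin t : ℂ) * w + (cos t : ℂ))) : ℝ) : ℂ)) z :=
    (Complex.ofRealCLM.contDiff.contDiffAt).comp _ (Complex.imCLM.contDiff.contDiffAt.comp _ h1)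
  have h3 := ((contDiffAt_const (c := 2 * Complex.I * B)).mul h2).neg
  exact ((Complex.contDiff_exp.contDiffAt.comp _ h3).contMDiffAt).comp z (isSmooth_coe z)

lemma IsSmooth.expS {f : ℍ → ℂ} (hf : IsSmooth f) (B : ℝ) {t : ℝ} (ht : |t| < π) :
    IsSmooth (expS B t f) := by
  exact contDiff_mul.contMDiff.comp ((isSmooth_phaseS B ht).prodMk_space (hf.comp_smul (rotS t)))

lemma abs_angle_lt (a : Fin 4) : |angle a| < π := by
  have h : (a : ℝ) ≤ 3 := by exact_mod_cast Nat.le_of_lt_succ a.isLt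
  refine abs_lt_pi_of_nonneg (by unfold angle; positivity) ?_
  rw [angle]
  nlinarith [pi_pos]

lemma IsSmooth.magneticGen {f : ℍ → ℂ} (hf : IsSmooth f) (B : ℝ) (a : Fin 4) :
    IsSmooth (magneticGen B a f) :=
  ((hf.expS B (abs_angle_lt a)).comp_smul (scaleU mu)).expS B (by rw [abs_neg]; exact abs_angle_lt a)

lemma magneticGen_inv (B : ℝ) (a : Fin 4) :
    (MagneticBloch.magneticGen B a)⁻¹ =
      MagneticBloch.expS B (-angle a) * expU (-mu) * MagneticBloch.expS B (angle a) := by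
  rw [MagneticBloch.magneticGen, mul_inv_rev, mul_inv_rev, ← expS_neg, ← expS_neg, ← expU_neg,
    neg_neg, mul_assoc]

lemma IsSmooth.magneticGen_inv {f : ℍ → ℂ} (hf : IsSmooth f) (B : ℝ) (a : Fin 4) :
    IsSmooth ((MagneticBloch.magneticGen B a)⁻¹ f) := by
  rw [MagneticBloch.magneticGen_inv]
  exact ((hf.expS B (abs_angle_lt a)).comp_smul (scaleU (-mu))).expS B
    (by rw [abs_neg]; exact abs_angle_lt a)

lemma exists_bump {δ : ℝ} (hδ : 0 < δ) :
    ∃ f : ℍ → ℂ, IsSmooth f ∧ f UpperHalfPlane.I = 1 ∧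
      ∀ z, f z ≠ 0 → dist z UpperHalfPlane.I < δ := by
  have hopen : IsOpen (((↑) : ℍ → ℂ) '' Metric.ball UpperHalfPlane.I δ) :=
    UpperHalfPlane.isOpenEmbedding_coe.isOpenMap _ Metric.isOpen_ball
  obtain ⟨r, hr, hball⟩ := Metric.isOpen_iff.mp hopen _
    ⟨UpperHalfPlane.I, Metric.mem_ball_self hδ, rfl⟩
  let b : ContDiffBump ((UpperHalfPlane.I : ℍ) : ℂ) := ⟨r / 2, r, by positivity, by linarith⟩
  refine ⟨fun z => (b (z : ℂ) : ℂ), ?_, ?_, ?_⟩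
  · exact (Complex.ofRealCLM.contDiff.comp b.contDiff).contMDiff.comp isSmooth_coe
  · exact congrArg Complex.ofReal
      (b.one_of_mem_closedBall (Metric.mem_closedBall_self b.rIn_pos.le))
  · intro z hz
    have : (z : ℂ) ∈ Metric.ball ((UpperHalfPlane.I : ℍ) : ℂ) r := by
      by_contra hmem
      exact hz (by simpa using b.zero_of_le_dist (by simpa using hmem))
    obtain ⟨w, hw, hwz⟩ := hball this
    rw [← UpperHalfPlane.ext hwz]
    exact hw

end Smoothness

/-! ### The action of the surface group on families of functions -/

section TwistedOperators

/-- The permutation `(ψ_n) ↦ (c_n E ψ_{σ n})` of families of functions. -/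
def twist {ι : Type*} (E : (ℍ → ℂ) ≃ₗ[ℂ] (ℍ → ℂ)) (σ : Equiv.Perm ι) (c : ι → ℂˣ) :
    Equiv.Perm (ι → ℍ → ℂ) where
  toFun Ψ n := c n • E (Ψ (σ n))
  invFun Ψ n := (c (σ⁻¹ n))⁻¹ • E⁻¹ (Ψ (σ⁻¹ n))
  left_inv Ψ := by
    funext n
    change (c (σ⁻¹ n))⁻¹ • E.symm (c (σ⁻¹ n) • E (Ψ (σ (σ⁻¹ n)))) = Ψ n
    simp [Units.smul_def]
  right_inv Ψ := by
    funext n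
    change c n • E ((c (σ⁻¹ (σ n)))⁻¹ • E.symm (Ψ (σ⁻¹ (σ n)))) = Ψ n
    simp [Units.smul_def]

variable {ι : Type*} (E : (ℍ → ℂ) ≃ₗ[ℂ] (ℍ → ℂ)) (σ : Equiv.Perm ι) (c : ι → ℂˣ)

lemma twist_apply (Ψ : ι → ℍ → ℂ) (n : ι) : twist E σ c Ψ n = (c n : ℂ) • E (Ψ (σ n)) := rfl

lemma twist_inv_apply (Ψ : ι → ℍ → ℂ) (n : ι) :
    (twist E σ c)⁻¹ Ψ n = (c (σ⁻¹ n) : ℂ)⁻¹ • E⁻¹ (Ψ (σ⁻¹ n)) := by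
  rw [← Units.val_inv_eq_inv_val]; rfl

variable {q : ℕ} [NeZero q]

/-- The scalars of `blochOp`: `e^{-ik_{a+1}}`, times `e^{inφ}` for the generator `γ̂_2`, which has
`a = 1`. Here `e^{inφ} = e^{2πipn/q}` is written as a character of `ZMod q`. -/
noncomputable def blochScalar (p : ℤ) (k : Fin 4 → ℝ) (a : Fin 4) (n : ZMod q) : ℂˣ :=
  Units.mk0 (Complex.exp (-(Complex.I * k a)) *
      if a = 1 then ZMod.stdAddChar ((p : ZMod q) * n) else 1)
    (mul_ne_zero (Complex.exp_ne_zero _) (by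
      split_ifs
      · rw [ZMod.stdAddChar_apply]; exact Circle.coe_ne_zero _
      · exact one_ne_zero))

/-- The permutation of indices of `blochOp`: `n ↦ n - 1` for the generator `γ̂_1`, which has
`a = 0`. -/
def blochShift (a : Fin 4) : Equiv.Perm (ZMod q) := if a = 0 then Equiv.subRight 1 else 1

/-- The operator on families `(ψ_n)` whose fixed points are the families that satisfy the Bloch
condition for the generator `γ̂_{a+1}`. -/
noncomputable def blochOp (B : ℝ) (p : ℤ) (k : Fin 4 → ℝ) (a : Fin 4) :
    Equiv.Perm (ZMod q → ℍ → ℂ) :=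
  twist (magneticGen B a) (blochShift a) (blochScalar p k a)

lemma blochOp_apply (B : ℝ) (p : ℤ) (k : Fin 4 → ℝ) (a : Fin 4) (Φ : ZMod q → ℍ → ℂ)
    (n : ZMod q) (z : ℍ) : blochOp B p k a Φ n z =
      ((blochScalar p k a n : ℂ) * phaseFactor (magneticGen B a) z) *
        Φ (blochShift a n) (fuchsianGen a • z) := by
  rw [blochOp, twist_apply, Pi.smul_apply, magneticGen_apply, smul_eq_mul, mul_assoc]

variable {B : ℝ} {p : ℤ}

lemma exp_eq_stdAddChar (hB : B = (p : ℝ) / (2 * (q : ℝ))) (n : ℤ) :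
    Complex.exp (4 * Real.pi * Complex.I * B * n) =
      ZMod.stdAddChar ((p : ZMod q) * (n : ZMod q)) := by
  have hq : (q : ℂ) ≠ 0 := by exact_mod_cast NeZero.ne q
  rw [← Int.cast_mul, ZMod.stdAddChar_coe, hB]
  congr 1
  push_cast
  field_simp
  ring

/-- The octagon relation of the magnetic Fuchsian group, with the scalar `e^{iφ}`. -/
lemma magneticGen_relation (B : ℝ) (f : ℍ → ℂ) :
    (magneticGen B 0)⁻¹ ((magneticGen B 3)⁻¹ (magneticGen B 2 ((magneticGen B 1)⁻¹ (magneticGen B 0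
      (magneticGen B 3 ((magneticGen B 2)⁻¹ (magneticGen B 1 f))))))) =
      Complex.exp (4 * Real.pi * Complex.I * B) • f := by
  have h := octagonRelator_magneticSide B
  rw [← signedGen_eq (magneticSide_add_four B)] at h
  simp only [magneticSide_natCast] at h
  rw [← expS_two_pi_apply, ← h]
  simp only [octagonRelator_signedGen, LinearEquiv.mul_apply, inv_inv]

/-- The scalars and the shift contribute `e^{-iφ}` to the octagon relation. -/
lemma octagonRelator_blochOp (hB : B = (p : ℝ) / (2 * (q : ℝ))) (k : Fin 4 → ℝ) :
    octagonRelator (signedGen fun a => (blochOp (q := q) B p k a)⁻¹) = 1 := by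
  have hw : octagonRelator (signedGen fun a => (blochOp (q := q) B p k a)⁻¹) =
      (blochOp B p k 0)⁻¹ * (blochOp B p k 3)⁻¹ * blochOp B p k 2 * (blochOp B p k 1)⁻¹ *
        blochOp B p k 0 * blochOp B p k 3 * (blochOp B p k 2)⁻¹ * blochOp B p k 1 := by
    simp only [octagonRelator_signedGen, inv_inv]
  rw [hw]
  ext1 Ψ
  funext n
  have hp := exp_eq_stdAddChar (q := q) hB 1
  simp only [Int.cast_one, mul_one] at hp
  simp only [Equiv.Perm.mul_apply, blochOp, twist_apply, twist_inv_apply, map_smul,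
    magneticGen_relation, smul_smul, hp]
  have hs0 : ∀ m : ZMod q, (blochShift 0)⁻¹ m = m + 1 := fun m => rfl
  have hs0' : ∀ m : ZMod q, blochShift 0 m = m - 1 := fun m => rfl
  have hs1 : (blochShift 1 : Equiv.Perm (ZMod q)) = 1 := rfl
  have hs2 : (blochShift 2 : Equiv.Perm (ZMod q)) = 1 := rfl
  have hs3 : (blochShift 3 : Equiv.Perm (ZMod q)) = 1 := rfl
  have hχ : ∀ m : ZMod q, ZMod.stdAddChar m ≠ 0 := fun m => by
    rw [ZMod.stdAddChar_apply]; exact Circle.coe_ne_zero _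
  have h21 : (2 : Fin 4) ≠ 1 := by decide
  have h31 : (3 : Fin 4) ≠ 1 := by decide
  have h01 : (0 : Fin 4) ≠ 1 := by decide
  simp only [hs1, hs2, hs3, inv_one, Equiv.Perm.one_apply, hs0, hs0', add_sub_cancel_right,
    blochScalar, Units.val_mk0, h21, h31, h01, if_false, if_true, mul_one, mul_add,
    AddChar.map_add_eq_mul]
  have h1 := hχ (p : ZMod q)
  have h2 := hχ ((p : ZMod q) * n)
  have he : ∀ a, Complex.exp (-(Complex.I * k a)) ≠ 0 := fun a => Complex.exp_ne_zero _
  have e0 := he 0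
  have e1 := he 1
  have e2 := he 2
  have e3 := he 3
  convert one_smul ℂ (Ψ n) using 2
  field_simp

/-- The action of `OctagonGroup` on families of functions in which the inverse generators act by
`blochOp`. -/
noncomputable def toBlochOp (hB : B = (p : ℝ) / (2 * (q : ℝ))) (k : Fin 4 → ℝ) :
    OctagonGroup →* Equiv.Perm (ZMod q → ℍ → ℂ) :=
  octagonHom (signedGen fun a => (blochOp B p k a)⁻¹) (signedGen_add_four _)
    (octagonRelator_blochOp hB k)

variable (hB : B = (p : ℝ) / (2 * (q : ℝ))) (k : Fin 4 → ℝ)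

lemma toBlochOp_of_inv (a : Fin 4) : toBlochOp hB k (.of a)⁻¹ = blochOp B p k a := by
  rw [map_inv, toBlochOp, octagonHom_of, signedGen_natCast, inv_inv]

lemma octagonGroup_induction {P : OctagonGroup → Prop} (of_inv : ∀ a, P (.of a)⁻¹)
    (one : P 1) (mul : ∀ g h, P g → P h → P (g * h)) (inv : ∀ g, P g → P g⁻¹) (g : OctagonGroup) :
    P g := by
  have hg : g ∈ Subgroup.closure (Set.range (PresentedGroup.of : Fin 4 → OctagonGroup)) := by
    rw [PresentedGroup.closure_range_of]; trivial
  induction hg using Subgroup.closure_induction with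
  | mem g hg =>
    obtain ⟨a, rfl⟩ := hg
    simpa using inv _ (of_inv a)
  | one => exact one
  | mul g h _ _ hg hh => exact mul g h hg hh
  | inv g _ hg => exact inv g hg

/-- `g` moves supports by the corresponding element of the Fuchsian group. -/
lemma toBlochOp_eq_zero_iff (g : OctagonGroup) : ∀ (Ψ : ZMod q → ℍ → ℂ) (z : ℍ),
    (∀ n, toBlochOp hB k g Ψ n z = 0) ↔ ∀ n, Ψ n ((toFuchsian g)⁻¹ • z) = 0 := by
  induction g using octagonGroup_induction with
  | of_inv a =>
    intro Ψ z
    have hne : phaseFactor (magneticGen B a) z ≠ 0 := fun h0 => by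
      simpa [h0] using norm_phaseFactor_magneticGen B a z
    rw [toBlochOp_of_inv, map_inv, inv_inv, toFuchsian_of,
      ← (blochShift (q := q) a).forall_congr_right (q := fun n => Ψ n (fuchsianGen a • z) = 0)]
    refine forall_congr' fun n => ?_
    rw [blochOp_apply, mul_eq_zero, or_iff_right (mul_ne_zero (Units.ne_zero _) hne)]
  | one => simp
  | mul g h hg hh =>
    intro Ψ z
    rw [map_mul, Equiv.Perm.mul_apply, hg, hh, map_mul, mul_inv_rev, mul_smul]
  | inv g hg =>
    intro Ψ z
    have := hg (toBlochOp hB k g⁻¹ Ψ) (toFuchsian g • z)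
    rw [inv_smul_smul, ← Equiv.Perm.mul_apply, ← map_mul, mul_inv_cancel, map_one] at this
    rw [map_inv toFuchsian, inv_inv]
    exact this.symm

lemma isSmooth_toBlochOp_iff (g : OctagonGroup) : ∀ Ψ : ZMod q → ℍ → ℂ,
    (∀ n, IsSmooth (toBlochOp hB k g Ψ n)) ↔ ∀ n, IsSmooth (Ψ n) := by
  have hsmul : ∀ (c : ℂ) (f : ℍ → ℂ), IsSmooth f → IsSmooth (c • f) := fun c f hf =>
    (contDiff_const.mul contDiff_id : ContDiff ℝ ∞ fun w : ℂ => c * w).contMDiff.comp hf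
  induction g using octagonGroup_induction with
  | of_inv a =>
    intro Ψ
    rw [toBlochOp_of_inv]
    constructor
    · intro h n
      have h2 : ∀ n, IsSmooth ((blochOp B p k a)⁻¹ (blochOp B p k a Ψ) n) := fun n => by
        generalize blochOp B p k a Ψ = Φ at h
        rw [blochOp, twist_inv_apply]
        exact hsmul _ _ ((h _).magneticGen_inv B a)
      rw [← Equiv.Perm.mul_apply, inv_mul_cancel] at h2
      exact h2 n
    · intro h n
      exact hsmul _ _ ((h _).magneticGen B a)
  | one => simp
  | mul g h hg hh =>
    intro Ψ
    rw [map_mul, Equiv.Perm.mul_apply, hg, hh]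
  | inv g hg =>
    intro Ψ
    have := hg (toBlochOp hB k g⁻¹ Ψ)
    rw [← Equiv.Perm.mul_apply, ← map_mul, mul_inv_cancel, map_one] at this
    exact this.symm

end TwistedOperators

/-! ### Poincaré series -/

section PoincareSeries

variable {q : ℕ} [NeZero q] {B : ℝ} {p : ℤ} (hB : B = (p : ℝ) / (2 * (q : ℝ))) (k : Fin 4 → ℝ)

/-- The sum of the translates of `Ψ`. It is a pointwise finite sum, so that `finsum` has its usual
meaning, if `Ψ` is supported in the disc of radius `μ/4` about `i`. -/
noncomputable def poincareSeries (Ψ : ZMod q → ℍ → ℂ) (n : ZMod q) (z : ℍ) : ℂ :=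
  ∑ᶠ g : OctagonGroup, toBlochOp hB k g Ψ n z

lemma blochOp_poincareSeries (Ψ : ZMod q → ℍ → ℂ) (a : Fin 4) :
    blochOp B p k a (poincareSeries hB k Ψ) = poincareSeries hB k Ψ := by
  funext n z
  rw [blochOp_apply, poincareSeries, mul_finsum]
  refine (finsum_congr fun g => ?_).trans
    (finsum_comp_equiv (Equiv.mulLeft (PresentedGroup.of a : OctagonGroup)⁻¹))
  rw [← blochOp_apply, Equiv.coe_mulLeft, map_mul, Equiv.Perm.mul_apply, toBlochOp_of_inv]

variable {Ψ : ZMod q → ℍ → ℂ}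
  (hΨ : ∀ n z, Ψ n z ≠ 0 → dist z UpperHalfPlane.I < mu / 4)

include hΨ in
lemma dist_lt_of_toBlochOp_ne_zero {g : OctagonGroup} {n : ZMod q} {z : ℍ}
    (h : toBlochOp hB k g Ψ n z ≠ 0) : dist z (toFuchsian g • UpperHalfPlane.I) < mu / 4 := by
  have h1 : ¬ ∀ n, toBlochOp hB k g Ψ n z = 0 := fun h0 => h (h0 n)
  rw [toBlochOp_eq_zero_iff] at h1
  push Not at h1
  obtain ⟨m, hm⟩ := h1
  have := hΨ m _ hm
  rwa [← dist_smul (toFuchsian g), smul_inv_smul] at this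

lemma eq_of_dist_lt {g h : OctagonGroup} (hgh : dist (toFuchsian g • UpperHalfPlane.I)
    (toFuchsian h • UpperHalfPlane.I) < mu) : g = h := by
  by_contra hne
  have h1 : h⁻¹ * g ≠ 1 := fun h0 => hne (inv_mul_eq_one.mp h0).symm
  have h2 := mu_lt_dist_toFuchsian h1
  rw [← dist_smul (toFuchsian h), smul_smul, ← map_mul, mul_inv_cancel_left] at h2
  exact lt_asymm hgh h2

include hΨ in
/-- On every disc of radius `μ/4` the sum has at most one non-zero term. -/
lemma exists_poincareSeries_eq (z₀ : ℍ) : ∃ g : OctagonGroup, ∀ n, ∀ z, dist z z₀ < mu / 4 →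
    poincareSeries hB k Ψ n z = toBlochOp hB k g Ψ n z := by
  by_cases h : ∃ g : OctagonGroup, ∃ n, ∃ z, dist z z₀ < mu / 4 ∧ toBlochOp hB k g Ψ n z ≠ 0
  · obtain ⟨g, m, w, hw, hne⟩ := h
    have hg := dist_lt_of_toBlochOp_ne_zero hB k hΨ hne
    refine ⟨g, fun n z hz => finsum_eq_single _ g fun g' hg' => ?_⟩
    by_contra hne'
    have h' := dist_lt_of_toBlochOp_ne_zero hB k hΨ hne'
    refine hg' (eq_of_dist_lt ?_)
    have t1 := dist_triangle4 (toFuchsian g' • UpperHalfPlane.I) z z₀ w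
    have t2 := dist_triangle (toFuchsian g' • UpperHalfPlane.I) w (toFuchsian g • UpperHalfPlane.I)
    rw [dist_comm _ z] at t1
    rw [dist_comm z₀ w] at t1
    linarith
  · push Not at h
    refine ⟨1, fun n z hz => ?_⟩
    rw [poincareSeries, h 1 n z hz, finsum_eq_zero_of_forall_eq_zero fun g => h g n z hz]

include hΨ in
lemma isSmooth_poincareSeries (hs : ∀ n, IsSmooth (Ψ n)) (n : ZMod q) :
    IsSmooth (poincareSeries hB k Ψ n) := by
  intro z
  obtain ⟨g, hg⟩ := exists_poincareSeries_eq hB k hΨ z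
  refine ((isSmooth_toBlochOp_iff hB k g Ψ).mpr hs n z).congr_of_eventuallyEq ?_
  filter_upwards [Metric.ball_mem_nhds z (by linarith [mu_pos] : 0 < mu / 4)] with w hw
  exact hg n w hw

include hΨ in
lemma poincareSeries_I (n : ZMod q) :
    poincareSeries hB k Ψ n UpperHalfPlane.I = Ψ n UpperHalfPlane.I := by
  rw [poincareSeries, finsum_eq_single _ 1, map_one, Equiv.Perm.one_apply]
  intro g hg
  by_contra hne
  have h := dist_lt_of_toBlochOp_ne_zero hB k hΨ hne
  have h2 := mu_lt_dist_toFuchsian hg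
  rw [dist_comm] at h
  linarith [mu_pos]

end PoincareSeries

/-! ### Existence of Bloch families -/

section BlochStates

theorem exists_blochStates (q : ℕ) [NeZero q] {B : ℝ} {p : ℤ}
    (hB : B = (p : ℝ) / (2 * (q : ℝ))) (k : Fin 4 → ℝ) :
    ∃ Ψ : ZMod q → ℍ → ℂ, (∀ n, IsSmooth (Ψ n)) ∧ Ψ 0 ≠ 0 ∧ ∀ a, blochOp B p k a Ψ = Ψ := by
  obtain ⟨b, hb, hbI, hbd⟩ := exists_bump (by linarith [mu_pos] : 0 < mu / 4)
  have hsupp : ∀ n z, (Pi.single 0 b : ZMod q → ℍ → ℂ) n z ≠ 0 →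
      dist z UpperHalfPlane.I < mu / 4 := by
    intro n z h
    by_cases hn : n = 0
    · subst hn
      exact hbd z (by simpa using h)
    · simp [hn] at h
  refine ⟨poincareSeries hB k (Pi.single 0 b), isSmooth_poincareSeries hB k hsupp fun n => ?_,
    fun h => ?_, blochOp_poincareSeries hB k _⟩
  · by_cases hn : n = 0
    · subst hn
      simpa using hb
    · rw [Pi.single_eq_of_ne hn]
      exact contMDiff_const
  · have := poincareSeries_I hB k hsupp 0
    simp [h, hbI] at this

end BlochStates

end MagneticBloch

theorem mainTheorem3 (p : ℤ) (q : ℕ) (hq : 0 < q) (hpq : IsCoprime p (q : ℤ)) (B φ : ℝ)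
    (hB : B = (p : ℝ) / (2 * (q : ℝ))) (hφ : φ = 4 * Real.pi * B) :
    -- the phase factor `j` is a `U(1)`-valued factor of automorphy
    (∀ E ∈ MagneticBloch.magneticFuchsianGroup B, ∃ γ ∈ MagneticBloch.fuchsianGroup, ∀ z : ℍ,
      ‖MagneticBloch.phaseFactor E z‖ = 1 ∧
      (∀ f : ℍ → ℂ, E f z = MagneticBloch.phaseFactor E z * f (γ • z)) ∧
      (∀ F ∈ MagneticBloch.magneticFuchsianGroup B, MagneticBloch.phaseFactor (E * F) z =
        MagneticBloch.phaseFactor E z * MagneticBloch.phaseFactor F (γ • z))) ∧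
    -- the magnetic Bloch states; `k 0, …, k 3` are `k_1, …, k_4`
    ∃ ψ : ℤ → (Fin 4 → ℝ) → ℍ → ℂ, ∀ k : Fin 4 → ℝ,
      (∀ n : ℤ, ContMDiff 𝓘(ℝ, ℂ) 𝓘(ℝ, ℂ) ∞ (ψ n k)) ∧
      LinearIndependent ℂ (fun n : Fin q => ψ (n : ℤ) k) ∧
      ∀ n : ℤ,
        ψ (n + q) k = ψ n k ∧
        (∀ (a : Fin 4) (z : ℍ), MagneticBloch.magneticGen B a (ψ n k) z =
          MagneticBloch.phaseFactor (MagneticBloch.magneticGen B a) z *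
            ψ n k (MagneticBloch.fuchsianGen a • z)) ∧
        MagneticBloch.magneticGen B 0 (ψ n k) =
          Complex.exp (Complex.I * (k 0 : ℂ)) • ψ (n + 1) k ∧
        (MagneticBloch.magneticGen B 0 ^ q) (ψ n k) =
          Complex.exp (Complex.I * (k 0 : ℂ) * (q : ℂ)) • ψ (n + q) k ∧
        MagneticBloch.magneticGen B 1 (ψ n k) =
          Complex.exp (Complex.I * (k 1 : ℂ) - Complex.I * (n : ℂ) * (φ : ℂ)) • ψ n k ∧
        (∀ a : Fin 4, a = 2 ∨ a = 3 → MagneticBloch.magneticGen B a (ψ n k) =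
          Complex.exp (Complex.I * (k a : ℂ)) • ψ n k) := by
  open MagneticBloch in
  have : NeZero q := ⟨hq.ne'⟩
  refine ⟨fun E hE => ?_, ?_⟩
  · obtain ⟨γ, hγ, h⟩ := exists_fuchsian_of_mem hE
    exact ⟨γ, hγ, fun z => ⟨(h z).1, (h z).2, fun F _ => (h z).2 _⟩⟩
  -- `Ψ k` is a fixed point, indexed by `ZMod q`, for the quasimomentum `k`.
  choose Ψ hsmooth hne hfix using exists_blochStates q hB
  have hgen : ∀ k a n, magneticGen B a (Ψ k (blochShift a n)) =
      (blochScalar p k a n : ℂ)⁻¹ • Ψ k n := fun k a n => by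
    conv_rhs => rw [← hfix k a, blochOp, twist_apply]
    rw [inv_smul_smul₀ (Units.ne_zero _)]
  have hscalar : ∀ k a (n : ZMod q), a ≠ 1 →
      (blochScalar p k a n : ℂ)⁻¹ = Complex.exp (Complex.I * k a) := fun k a n ha => by
    rw [blochScalar, Units.val_mk0, if_neg ha, mul_one, ← Complex.exp_neg, neg_neg]
  have h0 : ∀ k (n : ℤ), magneticGen B 0 (Ψ k n) =
      Complex.exp (Complex.I * k 0) • Ψ k ((n + 1 : ℤ) : ZMod q) := fun k n => by
    have h := hgen k 0 ((n + 1 : ℤ) : ZMod q)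
    rw [hscalar k 0 _ (by decide)] at h
    rw [← h]
    congr 2
    change (n : ZMod q) = ((n + 1 : ℤ) : ZMod q) - 1
    push_cast
    ring
  have h1 : ∀ k (n : ℤ), magneticGen B 1 (Ψ k n) =
      Complex.exp (Complex.I * k 1 - Complex.I * n * φ) • Ψ k n := fun k n => by
    have h := hgen k 1 (n : ZMod q)
    have hs : (blochShift 1 : Equiv.Perm (ZMod q)) = 1 := rfl
    rw [hs, Equiv.Perm.one_apply, blochScalar, Units.val_mk0, if_pos rfl, ← exp_eq_stdAddChar hB,
      ← Complex.exp_add, ← Complex.exp_neg] at h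
    rw [h, hφ]
    congr 2
    push_cast
    ring
  have hpow : ∀ k (m : ℕ) (n : ℤ), (magneticGen B 0 ^ m) (Ψ k n) =
      Complex.exp (Complex.I * k 0 * m) • Ψ k ((n + m : ℤ) : ZMod q) := by
    intro k m
    induction m with
    | zero => intro n; simp
    | succ m ih =>
      intro n
      rw [pow_succ, LinearEquiv.mul_apply, h0, map_smul, ih, smul_smul, ← Complex.exp_add]
      congr 2
      · push_cast; ring
      · push_cast; ring
  have hnz : ∀ k (n : ℕ), Ψ k (n : ZMod q) ≠ 0 := by
    intro k n hn
    have h := hpow k n 0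
    rw [zero_add, Int.cast_natCast, hn, smul_zero, Int.cast_zero] at h
    exact hne k ((LinearEquiv.map_eq_zero_iff _).mp h)
  refine ⟨fun n k => Ψ k n, fun k => ⟨fun n => hsmooth k n, ?_, fun n => ?_⟩⟩
  · refine Module.End.eigenvectors_linearIndependent' (magneticGen B 1 : (ℍ → ℂ) →ₗ[ℂ] (ℍ → ℂ))
      (fun n : Fin q => Complex.exp (Complex.I * k 1 - Complex.I * ((n : ℕ) : ℤ) * φ)) ?_ _
      fun n => ⟨Module.End.mem_eigenspace_iff.mpr (h1 k (n : ℕ)), by simpa using hnz k n⟩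
    intro m n hmn
    have e : ∀ n : ℤ, Complex.exp (Complex.I * k 1 - Complex.I * n * φ) =
        Complex.exp (Complex.I * k 1) * (ZMod.stdAddChar ((p : ZMod q) * (n : ZMod q)))⁻¹ :=
      fun n => by
        rw [← exp_eq_stdAddChar hB, ← Complex.exp_neg, ← Complex.exp_add, hφ]
        congr 1
        push_cast
        ring
    simp only [e] at hmn
    have h2 := ZMod.injective_stdAddChar
      (inv_injective (mul_left_cancel₀ (Complex.exp_ne_zero _) hmn))
    obtain ⟨u, v, huv⟩ := hpq
    have hu : (u : ZMod q) * p = 1 := by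
      have := congrArg (Int.cast : ℤ → ZMod q) huv
      simpa using this
    have h3 := congrArg ((u : ZMod q) * ·) h2
    simp only [← mul_assoc, hu, one_mul, Int.cast_natCast] at h3
    rw [ZMod.natCast_eq_natCast_iff, Nat.ModEq, Nat.mod_eq_of_lt m.2, Nat.mod_eq_of_lt n.2] at h3
    exact Fin.ext h3
  · refine ⟨by simp, fun a z => magneticGen_apply B a _ z, h0 k n, hpow k q n, h1 k n, ?_⟩
    intro a ha
    have hs : (blochShift a : Equiv.Perm (ZMod q)) = 1 := by
      rcases ha with rfl | rfl <;> rfl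
    have h := hgen k a (n : ZMod q)
    rwa [hs, Equiv.Perm.one_apply, hscalar k a _ (by rcases ha with rfl | rfl <;> decide)] at h
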